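/- All manifolds are smooth Banach manifolds (without boundary) and all objects are $C^\infty$. Let $\pi:E\to M$ be a vector bundle with the pullback bundle $\pi^*E=\{(a,b)\in E\times E\mid \pi(a)=\pi(b)\}\to E$, $(a,b)\mapsto a$. *Notation.* The vertical lift is $\xi^{V}(a,b)=\frac{d}{ds}(a+sb)\big|_{s=0}\in T_aE$ for $(a,b)\in\pi^*E$. It is an isomorphism of $\pi^*E$ onto $\mathrm{Ver}\,\pi=\ker T\pi$, and $\nu_\pi:\mathrm{Ver}\,\pi\to E$ is defined by $\nu_\pi(\xi^{V}(a,b))=b$. A section of $E$ along $\pi$ is a smooth map $\sigma:E\to E$ with $\pi\circ\sigma=\pi$; it is identified with the section $a\mapsto(a,\sigma(a))$ of $\pi^*E$, and $\sigma^V(a)=\xi^{V}(a,\sigma(a))$ is its vertical lift, a vector field on $E$. A vector tangent to $\pi^*E$ at $(a,b)$ is identified with a pair $(w_1,w_2)\in T_aE\times T_bE$ with $T\pi(w_1)=T\pi(w_2)$. The operations $+_\tau$ and $\cdot_\tau$ of the vector bundle $T\pi:TE\to TM$ are the tangent maps of the fibrewise addition $\pi^*E\to E$ and of the multiplication by scalars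 in $E$. For $v,w\in TE$ with $T\pi(v)=T\pi(w)$ put $\xi^V_{T\pi}(v,w)=\frac{d}{ds}(v+_\tau s\cdot_\tau w)\big|_{s=0}\in T(TE)$, and define $\nu_{T\pi}$ on $\mathrm{Ver}(T\pi)=\ker T(T\pi)\subset T(TE)$ by $\nu_{T\pi}(\xi^V_{T\pi}(v,w))=w$. *Connections.* A (nonlinear) connection on $E$ is a smooth, fibrewise linear map $\xi^H:\pi^*TM\to TE$ over $E$ with $\xi^H(a,v)\in T_aE$ and $T\pi(\xi^H(a,v))=v$. Its projectors are $P_H(w)=\xi^H(a,T\pi(w))$ and $P_V(w)=w-P_H(w)$ for $w\in T_aE$, and its connector is $\kappa:TE\to E$, $\kappa(w)=\nu_\pi(P_V(w))\in E_{\pi(a)}$ for $w\in T_aE$. The linearization of the connection is the connection on the bundle $\pi^*E\to E$ with horizontal lift $$\big((a,b),w\big)\mapsto (w,B(a,b)w),\qquad B(a,b)w=\nu_{T\pi}\Big(\tfrac{d}{ds}\,\xi^H(a+sb,T\pi(w))\Big|_{s=0}\Big)\in T_bE,\qquad w\in T_aE .$$ The covariant derivative associated to it is $D_w\zeta=\bar\kappa(T\zeta(w))$,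 for $\zeta$ a section of $\pi^*E\to E$ and $w\in TE$, where $\bar\kappa$ is the connector of the linearization. On sections $\sigma$ of $E$ along $\pi$ it is regarded as taking values in sections of $E$ along $\pi$. **Theorem.** Let $\xi^H$ be a connection on $E$. For every section $\sigma$ of $E$ along $\pi$ and every vector field $W\in\mathfrak X(E)$, $$D_W\sigma=\kappa\big([P_H(W),\sigma^V]\big)+\kappa\big(T\sigma(P_V(W))\big),$$ that is, for every $a\in E$, $$(D_{W}\sigma)(a)=\kappa\big([P_H(W),\sigma^V](a)\big)+\kappa\big(T_a\sigma(P_V(W(a)))\big)\in E_{\pi(a)},$$ where $[P_H(W),\sigma^V](a)\in T_aE$ and $T_a\sigma(P_V(W(a)))\in T_{\sigma(a)}E$. -/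

import Mathlib

open Bundle Set
open scoped Manifold ContDiff Bundle

noncomputable section

namespace NonlinearConnection

/-- The velocity at time `0` of a curve `c` in a manifold `N`, as a point of the tangent bundle. -/
def velocity {V : Type*} [NormedAddCommGroup V] [NormedSpace ℝ V]
    {G : Type*} [TopologicalSpace G] (J : ModelWithCorners ℝ V G)
    {N : Type*} [TopologicalSpace N] [ChartedSpace G N] (c : ℝ → N) : TangentBundle J N :=
  ⟨c 0, mfderiv 𝓘(ℝ, ℝ) J c 0 (1 : ℝ)⟩

section VectorBundles

/-! ### Connections on a vector bundle `π : E → M` of Banach manifolds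

`M` is modelled on `V` (through the model with corners `I`), the typical fibre is `F`, the
total space is `TotalSpace F E`, a manifold with model `I.prod 𝓘(ℝ, F)`. -/

variable {V : Type*} [NormedAddCommGroup V] [NormedSpace ℝ V]
  {H : Type*} [TopologicalSpace H] (I : ModelWithCorners ℝ V H)
  {M : Type*} [TopologicalSpace M] [ChartedSpace H M]
  {F : Type*} [NormedAddCommGroup F] [NormedSpace ℝ F]
  {E : M → Type*} [∀ x, AddCommMonoid (E x)] [∀ x, Module ℝ (E x)]
  [TopologicalSpace (TotalSpace F E)] [∀ x, TopologicalSpace (E x)] [FiberBundle F E]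

/-- The tangent map `T_a π : T_a E → T_{π a} M` of the bundle projection. -/
def tangentProj (a : TotalSpace F E) :
    TangentSpace (I.prod 𝓘(ℝ, F)) a →L[ℝ] TangentSpace I a.proj :=
  mfderiv (I.prod 𝓘(ℝ, F)) I (TotalSpace.proj : TotalSpace F E → M) a

/-- The vertical lift `ξ^v(a, b) = d/ds (a + s b) |_{s = 0}`, a tangent vector to `E` at `a`. -/
def vertLift (a : TotalSpace F E) (b : E a.proj) : TangentSpace (I.prod 𝓘(ℝ, F)) a :=
  mfderiv 𝓘(ℝ, ℝ) (I.prod 𝓘(ℝ, F))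
    (fun s : ℝ ↦ (⟨a.proj, a.2 + s • b⟩ : TotalSpace F E)) 0 (1 : ℝ)

/-- The vertical projection `ν`, the inverse of the vertical lift: `ν (ξ^v(a, b)) = b`.
It is only meaningful on vertical vectors, i.e. on the kernel of `T_a π`. -/
def vertProj (a : TotalSpace F E) (w : TangentSpace (I.prod 𝓘(ℝ, F)) a) : E a.proj :=
  Function.invFun (vertLift I a) w

variable (F E) in
/-- Raw data of a horizontal lifting map `ξ^h : π^*TM → TE`, `(a, v) ↦ ξ^h(a, v) ∈ T_a E`. -/
abbrev HorizontalLift : Type _ :=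
  (a : TotalSpace F E) → TangentSpace I a.proj → TangentSpace (I.prod 𝓘(ℝ, F)) a

variable {I}

/-- The horizontal projector `P_h = ξ^h ∘ p_E`, where `p_E w = (τ_E w, Tπ w)`. -/
def horProjector (ξ : HorizontalLift I F E) (a : TotalSpace F E)
    (w : TangentSpace (I.prod 𝓘(ℝ, F)) a) : TangentSpace (I.prod 𝓘(ℝ, F)) a :=
  ξ a (tangentProj I a w)

/-- The vertical projector `P_v = id - P_h`. -/
def vertProjector (ξ : HorizontalLift I F E) (a : TotalSpace F E)
    (w : TangentSpace (I.prod 𝓘(ℝ, F)) a) : TangentSpace (I.prod 𝓘(ℝ, F)) a :=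
  w - horProjector ξ a w

/-- The connector (Dombrowski map) `κ : TE → E`; for `w ∈ T_a E`, `κ w ∈ E_{π a}` is the vertical
projection of `P_v w`. -/
def connector (ξ : HorizontalLift I F E) (a : TotalSpace F E)
    (w : TangentSpace (I.prod 𝓘(ℝ, F)) a) : E a.proj :=
  vertProj I a (vertProjector ξ a w)

/-- The covariant derivative `D_v s = κ (T s (v))` at `m` of a section `s` of `E` with respect to
a connection, for `v ∈ T_m M`. -/
def covariantDerivative (ξ : HorizontalLift I F E) (s : (m : M) → E m) (m : M)
    (v : TangentSpace I m) : E m :=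
  connector ξ ⟨m, s m⟩
    (mfderiv I (I.prod 𝓘(ℝ, F)) (fun x ↦ (⟨x, s x⟩ : TotalSpace F E)) m v)

end VectorBundles

section Pullback

variable {V : Type*} [NormedAddCommGroup V] [NormedSpace ℝ V]
  {H : Type*} [TopologicalSpace H] (I : ModelWithCorners ℝ V H)
  {M : Type*} [TopologicalSpace M] [ChartedSpace H M] [IsManifold I ∞ M]
  (F : Type*) [NormedAddCommGroup F] [NormedSpace ℝ F]
  (E : M → Type*) [∀ x, AddCommMonoid (E x)] [∀ x, Module ℝ (E x)]
  [TopologicalSpace (TotalSpace F E)] [∀ x, TopologicalSpace (E x)] [FiberBundle F E]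
  [VectorBundle ℝ F E] [ContMDiffVectorBundle ∞ F E I]

/-- The projection `π : E → M` as a smooth map. -/
abbrev proj : C^∞⟮I.prod 𝓘(ℝ, F), TotalSpace F E; I, M⟯ :=
  ⟨TotalSpace.proj, contMDiff_proj E⟩

variable {I F E} in
/-- A map `ξ^h : π^*TM → TE` is the horizontal lift of an Ehresmann connection on `E` when it is
a smooth, fibrewise linear right inverse of `p_E : TE → π^*TM`. -/
structure IsEhresmannConnection (ξ : HorizontalLift I F E) : Prop where
  isLinearMap : ∀ a, IsLinearMap ℝ (ξ a)
  tangentProj_lift : ∀ a v, tangentProj I a (ξ a v) = v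
  smooth : ContMDiff ((I.prod 𝓘(ℝ, F)).prod 𝓘(ℝ, V)) (I.prod 𝓘(ℝ, F)).tangent ∞
    (fun p : TotalSpace V (proj I F E *ᵖ (TangentSpace I : M → Type _)) ↦
      (⟨p.proj, ξ p.proj p.2⟩ : TangentBundle (I.prod 𝓘(ℝ, F)) (TotalSpace F E)))

/-- The total space of the pullback bundle `π^*E → E`. Its points are the pairs `(a, b)` of
points of `E` in the same fibre; the point `(a, b)` is `⟨a, b⟩`, with `b : E (π a)`. -/
abbrev PullbackTotal : Type _ := TotalSpace F (proj I F E *ᵖ E)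

variable {F E}

/-- The tangent vector to `π^*E` at `(a, b)` that corresponds to the pair `(w₁, w₂)`, where
`w₁ ∈ T_a E` and `w₂ ∈ T_b E` have the same image under `Tπ`: the vector whose images under the
tangent maps of `(a, b) ↦ a` and of `(a, b) ↦ b` are `w₁` and `w₂`. -/
def pairTangent (p : PullbackTotal I F E)
    (w₁ : TangentSpace (I.prod 𝓘(ℝ, F)) p.proj)
    (w₂ : TangentSpace (I.prod 𝓘(ℝ, F)) (Pullback.lift (proj I F E) p)) :
    TangentSpace ((I.prod 𝓘(ℝ, F)).prod 𝓘(ℝ, F)) p :=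
  Function.invFun
    (fun u : TangentSpace ((I.prod 𝓘(ℝ, F)).prod 𝓘(ℝ, F)) p ↦
      ((mfderiv ((I.prod 𝓘(ℝ, F)).prod 𝓘(ℝ, F)) (I.prod 𝓘(ℝ, F))
          (TotalSpace.proj : PullbackTotal I F E → TotalSpace F E) p u,
        mfderiv ((I.prod 𝓘(ℝ, F)).prod 𝓘(ℝ, F)) (I.prod 𝓘(ℝ, F))
          (Pullback.lift (proj I F E) : PullbackTotal I F E → TotalSpace F E) p u) :
        TangentSpace (I.prod 𝓘(ℝ, F)) p.proj ×
          TangentSpace (I.prod 𝓘(ℝ, F)) (Pullback.lift (proj I F E) p)))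
    (w₁, w₂)

/-! The operations `·_τ` and `+_τ` of the vector bundle `Tπ : TE → TM` are the tangent maps of the
multiplication by a scalar in `E` and of the addition `π^*E → E`, `(a, b) ↦ a + b`. -/

/-- Multiplication by a scalar in `Tπ : TE → TM`. For `w ∈ T_b E`, `r ·_τ w ∈ T_{r b} E`. -/
def tauSMul (r : ℝ) {m : M} (b : E m)
    (w : TangentSpace (I.prod 𝓘(ℝ, F)) (⟨m, b⟩ : TotalSpace F E)) :
    TangentSpace (I.prod 𝓘(ℝ, F)) (⟨m, r • b⟩ : TotalSpace F E) :=
  mfderiv (I.prod 𝓘(ℝ, F)) (I.prod 𝓘(ℝ, F))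
    (fun e : TotalSpace F E ↦ (⟨e.proj, r • e.2⟩ : TotalSpace F E)) ⟨m, b⟩ w

/-- Addition in `Tπ : TE → TM`. For `w₁ ∈ T_a E` and `w₂ ∈ T_b E` with the same image under `Tπ`,
`w₁ +_τ w₂ ∈ T_{a + b} E`. -/
def tauAdd {m : M} (a b : E m)
    (w₁ : TangentSpace (I.prod 𝓘(ℝ, F)) (⟨m, a⟩ : TotalSpace F E))
    (w₂ : TangentSpace (I.prod 𝓘(ℝ, F)) (⟨m, b⟩ : TotalSpace F E)) :
    TangentSpace (I.prod 𝓘(ℝ, F)) (⟨m, a + b⟩ : TotalSpace F E) :=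
  mfderiv ((I.prod 𝓘(ℝ, F)).prod 𝓘(ℝ, F)) (I.prod 𝓘(ℝ, F))
    (fun q : PullbackTotal I F E ↦
      let c : E q.proj.proj := q.2
      (⟨q.proj.proj, q.proj.2 + c⟩ : TotalSpace F E))
    ⟨⟨m, a⟩, b⟩ (pairTangent I ⟨⟨m, a⟩, b⟩ w₁ w₂)

/-- The vertical lift of `Tπ : TE → TM`: `ξ^v_{Tπ}(v, w) = d/ds (v +_τ s ·_τ w) |_{s = 0}`,
an element of `T(TE)`, for `v ∈ T_a E` and `w ∈ T_b E` with the same image under `Tπ`. -/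
def vertLiftT {m : M} (a b : E m)
    (v : TangentSpace (I.prod 𝓘(ℝ, F)) (⟨m, a⟩ : TotalSpace F E))
    (w : TangentSpace (I.prod 𝓘(ℝ, F)) (⟨m, b⟩ : TotalSpace F E)) :
    TangentBundle (I.prod 𝓘(ℝ, F)).tangent (TangentBundle (I.prod 𝓘(ℝ, F)) (TotalSpace F E)) :=
  velocity (I.prod 𝓘(ℝ, F)).tangent
    (fun s : ℝ ↦ (⟨⟨m, a + s • b⟩, tauAdd I a (s • b) v (tauSMul I s b w)⟩ :
      TangentBundle (I.prod 𝓘(ℝ, F)) (TotalSpace F E)))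

variable {I}

/-- `B(a, b) w = ν_{Tπ} (d/ds ξ^h(a + s b, Tπ w) |_{s = 0})` for `w ∈ T_a E`. Here `ν_{Tπ}` is the
inverse of the vertical lift of `Tπ`: `B(a, b) w` is the vector `w' ∈ T_b E` with `Tπ w' = Tπ w` and
`ξ^v_{Tπ}(ξ^h(a, Tπ w), w') = d/ds ξ^h(a + s b, Tπ w) |_{s = 0}`. -/
def linearizationB (ξ : HorizontalLift I F E) {m : M} (a b : E m)
    (w : TangentSpace (I.prod 𝓘(ℝ, F)) (⟨m, a⟩ : TotalSpace F E)) :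
    TangentSpace (I.prod 𝓘(ℝ, F)) (⟨m, b⟩ : TotalSpace F E) :=
  let v : TangentSpace I m := tangentProj I (⟨m, a⟩ : TotalSpace F E) w
  Classical.epsilon fun w' : TangentSpace (I.prod 𝓘(ℝ, F)) (⟨m, b⟩ : TotalSpace F E) ↦
    tangentProj I (⟨m, b⟩ : TotalSpace F E) w' = v ∧
    vertLiftT I a b (ξ ⟨m, a⟩ v) w' =
      velocity (I.prod 𝓘(ℝ, F)).tangent
        (fun s : ℝ ↦ (⟨⟨m, a + s • b⟩, ξ ⟨m, a + s • b⟩ v⟩ :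
          TangentBundle (I.prod 𝓘(ℝ, F)) (TotalSpace F E)))

/-- The linearization of a connection on `E`: the connection on the pullback bundle `π^*E → E`
with horizontal lift `((a, b), w) ↦ (w, B(a, b) w)`. -/
def linearization (ξ : HorizontalLift I F E) :
    HorizontalLift (I.prod 𝓘(ℝ, F)) F (proj I F E *ᵖ E) :=
  fun p w ↦ pairTangent I p w (linearizationB ξ p.proj.2 p.2 w)

/-- The covariant derivative of the linearized connection, acting on sections `σ` of `E` along `π`
(identified with the sections `a ↦ (a, σ a)` of the pullback bundle): `D_w σ` for `w ∈ T_a E`. -/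
def linearizedCovariantDerivative (ξ : HorizontalLift I F E)
    (σ : (a : TotalSpace F E) → E a.proj) (a : TotalSpace F E)
    (w : TangentSpace (I.prod 𝓘(ℝ, F)) a) : E a.proj :=
  covariantDerivative (E := proj I F E *ᵖ E) (linearization ξ) σ a w

end Pullback

end NonlinearConnection

end

/-! Both sides are local, so they can be compared in the chart of `E` induced by a chart of `M` and
a trivialization. There `ξ` sends `(z, x)` to `(x, G(z, x))` with `G` linear in `x` (`liftCoord`),
and `κ` sends `(x, η)` at `z` to `η - G(z, x)` (`fibreCoord_connector_eq`). Linearizing replaces `G`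
by its derivative along the fibre. If `S` is the local form of `σ` and `W = (X, Y)`, the left side
is therefore `dS(X, Y) - ∂G(z, X)·S`, with `∂` the fibre derivative at fixed `X`
(`fibreCoord_linearizedCovariantDerivative`). The bracket of `(X, G(z, X))` and `(0, S)` is `(-dX(0,
S), dS(X, G) - ∂G·S - G(z, dX(0, S)))`. Applying `κ` removes both terms in `dX`, by linearity of
`G`, and leaves `dS(X, G) - ∂G·S` (`fibreCoord_connector_mlieBracket`). The last term of the theorem
is `dS(0, Y - G)`, exactly what is missing from `dS(X, Y)`. -/

noncomputable section

namespace NonlinearConnection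

open Filter Topology

/-! ### Derivatives, velocities and Lie brackets read in charts. -/

section Charts

variable {V : Type*} [NormedAddCommGroup V] [NormedSpace ℝ V]
  {H : Type*} [TopologicalSpace H] (I : ModelWithCorners ℝ V H)
  {M : Type*} [TopologicalSpace M] [ChartedSpace H M]

/-- The derivative at `x` of the extended chart at `x₀`, with values in the model space. -/
def chartDeriv (x₀ x : M) : TangentSpace I x →L[ℝ] V :=
  mfderiv I 𝓘(ℝ, V) (extChartAt I x₀) x

variable {I}
variable [IsManifold I ∞ M]

/-- This allows tangent vectors at any point of the chart domain, not only at its centre, to be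
compared and constructed through their coordinates. -/
theorem chartDeriv_bijective {x₀ x : M} (hx : x ∈ (extChartAt I x₀).source) :
    Function.Bijective (chartDeriv I x₀ x) :=
  (isInvertible_mfderiv_extChartAt hx).bijective

variable [I.Boundaryless]
  {V' : Type*} [NormedAddCommGroup V'] [NormedSpace ℝ V']
  {H' : Type*} [TopologicalSpace H'] {I' : ModelWithCorners ℝ V' H'}
  {M' : Type*} [TopologicalSpace M'] [ChartedSpace H' M'] [IsManifold I' ∞ M']

theorem mdifferentiableAt_extChartAt_symm {x₀ : M} {y : V} (hy : y ∈ (extChartAt I x₀).target) :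
    MDifferentiableAt 𝓘(ℝ, V) I (extChartAt I x₀).symm y := by
  have h := mdifferentiableWithinAt_extChartAt_symm hy
  rwa [I.range_eq_univ, mdifferentiableWithinAt_univ] at h

/-- A map that reads `k` in charts is differentiable where `k` is. -/
theorem mdifferentiableAt_of_chart_eq {x₀ : M} {x₀' p : M'} {f : M' → M} {k : V' → V}
    (hp : p ∈ (extChartAt I' x₀').source) (hk : DifferentiableAt ℝ k (extChartAt I' x₀' p))
    (hs : ∀ᶠ p' in 𝓝 p, f p' ∈ (extChartAt I x₀).source)
    (h : ∀ᶠ p' in 𝓝 p, extChartAt I x₀ (f p') = k (extChartAt I' x₀' p')) :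
    MDifferentiableAt I' I f p := by
  have h1 : MDifferentiableAt I' 𝓘(ℝ, V') (extChartAt I' x₀') p :=
    mdifferentiableAt_extChartAt (by rwa [extChartAt_source] at hp)
  have h2 : MDifferentiableAt I' 𝓘(ℝ, V) (k ∘ extChartAt I' x₀') p :=
    hk.mdifferentiableAt.comp p h1
  have h3 : k (extChartAt I' x₀' p) ∈ (extChartAt I x₀).target := by
    rw [← h.self_of_nhds]
    exact (extChartAt I x₀).map_source hs.self_of_nhds
  have h4 := (mdifferentiableAt_extChartAt_symm h3).comp p h2
  refine h4.congr_of_eventuallyEq ?_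
  filter_upwards [hs, h] with p' hp1 hp2
  simp only [Function.comp_apply]
  rw [← hp2, (extChartAt I x₀).left_inv hp1]

/-- The derivative in charts of a map that reads `k` in charts. -/
theorem chartDeriv_mfderiv {x₀ : M} {x₀' p : M'} {f : M' → M} {k : V' → V} {k' : V' →L[ℝ] V}
    (hp : p ∈ (extChartAt I' x₀').source) (hk : HasFDerivAt k k' (extChartAt I' x₀' p))
    (hs : ∀ᶠ p' in 𝓝 p, f p' ∈ (extChartAt I x₀).source)
    (h : ∀ᶠ p' in 𝓝 p, extChartAt I x₀ (f p') = k (extChartAt I' x₀' p'))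
    (u : TangentSpace I' p) :
    chartDeriv I x₀ (f p) (mfderiv I' I f p u) = k' (chartDeriv I' x₀' p u) := by
  have hf := mdifferentiableAt_of_chart_eq hp hk.differentiableAt hs h
  have h0 : MDifferentiableAt I 𝓘(ℝ, V) (extChartAt I x₀) (f p) :=
    mdifferentiableAt_extChartAt (by simpa only [extChartAt_source] using hs.self_of_nhds)
  have h1 : MDifferentiableAt I' 𝓘(ℝ, V') (extChartAt I' x₀') p :=
    mdifferentiableAt_extChartAt (by rwa [extChartAt_source] at hp)
  have e1 := (h0.hasMFDerivAt.comp p hf.hasMFDerivAt)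
  have e2 := (hk.hasMFDerivAt.comp p h1.hasMFDerivAt)
  have e3 : (extChartAt I x₀ ∘ f) =ᶠ[𝓝 p] (k ∘ extChartAt I' x₀') := h
  have e4 := e2.congr_of_eventuallyEq e3
  have e5 := hasMFDerivAt_unique e1 e4
  exact DFunLike.congr_fun e5 u

/-- The velocity in a chart of a curve. -/
theorem chartDeriv_mfderiv_curve {x₀ : M} {c : ℝ → M} {k : ℝ → V} {d : V}
    (hk : HasDerivAt k d 0)
    (hs : ∀ s, c s ∈ (extChartAt I x₀).source) (h : ∀ s, extChartAt I x₀ (c s) = k s) :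
    MDifferentiableAt 𝓘(ℝ, ℝ) I c 0 ∧
    chartDeriv I x₀ (c 0) (mfderiv 𝓘(ℝ, ℝ) I c 0 (1 : ℝ)) = d := by
  have e : ∀ s : ℝ, extChartAt 𝓘(ℝ, ℝ) (0 : ℝ) s = s := fun s ↦ by
    rw [extChartAt_model_space_eq_id]; rfl
  have hk' : HasFDerivAt k (ContinuousLinearMap.toSpanSingleton ℝ d)
      (extChartAt 𝓘(ℝ, ℝ) (0 : ℝ) 0) := by rw [e]; exact hk.hasFDerivAt
  have h' : ∀ᶠ s in 𝓝 (0 : ℝ), extChartAt I x₀ (c s) = k (extChartAt 𝓘(ℝ, ℝ) (0 : ℝ) s) :=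
    .of_forall fun s ↦ by rw [e, h]
  refine ⟨mdifferentiableAt_of_chart_eq (mem_extChartAt_source (I := 𝓘(ℝ, ℝ)) (0 : ℝ))
    hk'.differentiableAt (.of_forall hs) h', ?_⟩
  have h1 : chartDeriv 𝓘(ℝ, ℝ) (0 : ℝ) 0 (1 : ℝ) = (1 : ℝ) := by
    unfold chartDeriv
    rw [mfderiv_extChartAt_self]; rfl
  have h2 := chartDeriv_mfderiv (mem_extChartAt_source (I := 𝓘(ℝ, ℝ)) (0 : ℝ)) hk'
    (.of_forall hs) h' (1 : ℝ)
  refine h2.trans ?_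
  rw [h1]
  simp

/-- Two curves in a chart domain have the same velocity iff they have the same initial point and
the same velocity in the chart. -/
theorem velocity_eq_iff {x₀ : M} {c₁ c₂ : ℝ → M} {k₁ k₂ : ℝ → V} {d₁ d₂ : V}
    (hk₁ : HasDerivAt k₁ d₁ 0) (hk₂ : HasDerivAt k₂ d₂ 0)
    (hs₁ : ∀ s, c₁ s ∈ (extChartAt I x₀).source) (hs₂ : ∀ s, c₂ s ∈ (extChartAt I x₀).source)
    (h₁ : ∀ s, extChartAt I x₀ (c₁ s) = k₁ s) (h₂ : ∀ s, extChartAt I x₀ (c₂ s) = k₂ s) :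
    velocity I c₁ = velocity I c₂ ↔ k₁ 0 = k₂ 0 ∧ d₁ = d₂ := by
  have e₁ := (chartDeriv_mfderiv_curve hk₁ hs₁ h₁).2
  have e₂ := (chartDeriv_mfderiv_curve hk₂ hs₂ h₂).2
  -- The two velocities may lie over different base points, so tangent vectors are compared by a
  -- function on the whole tangent bundle; `key` below handles the converse by substituting the
  -- equality of base points.
  let T : TangentBundle I M → V := fun q ↦ chartDeriv I x₀ q.proj q.2
  constructor
  · intro hv
    refine ⟨?_, ?_⟩
    · rw [← h₁, ← h₂]
      exact congrArg (fun q : TangentBundle I M ↦ extChartAt I x₀ q.proj) hv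
    · rw [← e₁, ← e₂]
      exact congrArg T hv
  · rintro ⟨h0, hd⟩
    have h0' : c₁ 0 = c₂ 0 := by
      apply (extChartAt I x₀).injOn (hs₁ 0) (hs₂ 0)
      rw [h₁, h₂, h0]
    unfold velocity
    have key : ∀ (x y : M) (v : TangentSpace I x) (w : TangentSpace I y), x = y →
        x ∈ (extChartAt I x₀).source → chartDeriv I x₀ x v = chartDeriv I x₀ y w →
        (⟨x, v⟩ : TangentBundle I M) = ⟨y, w⟩ := by
      rintro x _ v w rfl hx hvw
      rw [(chartDeriv_bijective hx).1 hvw]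
    exact key _ _ _ _ h0' (hs₁ 0) (by rw [e₁, e₂, hd])

omit [I.Boundaryless] in
/-- The chart of the tangent bundle. -/
theorem extChartAt_tangentBundle {q z : TangentBundle I M}
    (hz : z.proj ∈ (extChartAt I q.proj).source) :
    extChartAt I.tangent q z =
      (extChartAt I q.proj z.proj, chartDeriv I q.proj z.proj z.2) := by
  rw [extChartAt_source] at hz
  have h := TangentBundle.continuousLinearMapAt_trivializationAt (I := I) hz
  unfold chartDeriv
  rw [← h, ModelWithCorners.tangent, FiberBundle.extChartAt]
  have hb : z.proj ∈ (trivializationAt V (TangentSpace I : M → Type _) q.proj).baseSet := by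
    rwa [TangentBundle.trivializationAt_baseSet]
  refine Prod.ext rfl ?_
  rw [Bundle.Trivialization.continuousLinearMapAt_apply, Bundle.Trivialization.linearMapAt_apply,
    if_pos hb]
  rfl

omit [I.Boundaryless] in
theorem mem_extChartAt_tangentBundle_source {q z : TangentBundle I M} :
    z ∈ (extChartAt I.tangent q).source ↔ z.proj ∈ (extChartAt I q.proj).source := by
  rw [extChartAt_source, extChartAt_source]
  exact TangentBundle.mem_chart_source_iff _ _

/-- A vector field read in the chart at `x₀`. -/
def chartField (I : ModelWithCorners ℝ V H) (x₀ : M) (X : (x : M) → TangentSpace I x) (y : V) : V :=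
  chartDeriv I x₀ ((extChartAt I x₀).symm y) (X ((extChartAt I x₀).symm y))

theorem differentiableAt_chartField {X : (x : M) → TangentSpace I x}
    (hX : ContMDiff I I.tangent ∞ (fun x ↦ (⟨x, X x⟩ : TangentBundle I M))) (x₀ : M) :
    DifferentiableAt ℝ (chartField I x₀ X) (extChartAt I x₀ x₀) := by
  let q : TangentBundle I M := ⟨x₀, X x₀⟩
  have hy := mem_extChartAt_target (I := I) x₀
  have h1 : MDifferentiableAt 𝓘(ℝ, V) 𝓘(ℝ, V × V)
      (extChartAt I.tangent q ∘ (fun x ↦ (⟨x, X x⟩ : TangentBundle I M)) ∘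
        (extChartAt I x₀).symm) (extChartAt I x₀ x₀) := by
    have hX' : MDifferentiableAt I I.tangent (fun x ↦ (⟨x, X x⟩ : TangentBundle I M)) x₀ :=
      (hX x₀).mdifferentiableAt (by simp)
    have hq : MDifferentiableAt I.tangent 𝓘(ℝ, V × V) (extChartAt I.tangent q) q :=
      mdifferentiableAt_extChartAt (mem_chart_source _ _)
    refine hq.comp_of_eq _ (hX'.comp_of_eq _ (mdifferentiableAt_extChartAt_symm hy)
      (extChartAt_to_inv x₀)) ?_
    exact congrArg (fun x ↦ (⟨x, X x⟩ : TangentBundle I M)) (extChartAt_to_inv x₀)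
  have h2 : DifferentiableAt ℝ _ _ := h1.differentiableAt.snd
  refine h2.congr_of_eventuallyEq ?_
  filter_upwards [extChartAt_target_mem_nhds (I := I) x₀] with y hy
  simp only [Function.comp_apply]
  rw [extChartAt_tangentBundle]
  · rfl
  · exact (extChartAt I x₀).map_target hy

/-- The manifold bracket is the bracket of the pullbacks by the inverse chart, transported back.
Near the centre these pullbacks are `chartField`s, since the derivatives of the chart and of its
inverse are mutually inverse. Absence of boundary makes the range of `I` the whole space. -/
theorem chartDeriv_mlieBracket (X Y : (x : M) → TangentSpace I x) (x₀ : M) :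
    chartDeriv I x₀ x₀ (VectorField.mlieBracket I X Y x₀) =
      VectorField.lieBracket ℝ (chartField I x₀ X) (chartField I x₀ Y) (extChartAt I x₀ x₀) := by
  have hx := mem_extChartAt_source (I := I) x₀
  have key : ∀ Z : (x : M) → TangentSpace I x,
      VectorField.mpullbackWithin 𝓘(ℝ, V) I (extChartAt I x₀).symm Z (range I)
        =ᶠ[𝓝 (extChartAt I x₀ x₀)] chartField I x₀ Z := by
    intro Z
    filter_upwards [extChartAt_target_mem_nhds (I := I) x₀] with y hy
    refine (isInvertible_mfderivWithin_extChartAt_symm hy).inverse_apply_eq.2 ?_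
    have := mfderivWithin_extChartAt_symm_comp_mfderiv_extChartAt hy
    exact (DFunLike.congr_fun this (Z ((extChartAt I x₀).symm y))).symm
  rw [VectorField.mlieBracket, VectorField.mlieBracketWithin_apply]
  refine ((isInvertible_mfderiv_extChartAt hx).self_apply_inverse _).trans ?_
  have hset : (extChartAt I x₀).symm ⁻¹' univ ∩ range I = univ := by simp [I.range_eq_univ]
  rw [hset]
  exact (VectorField.lieBracketWithin_univ (𝕜 := ℝ) (E := V) ▸
    Filter.EventuallyEq.lieBracket_vectorField_eq (𝕜 := ℝ) (E := V) (key X) (key Y) :)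

end Charts

/-! ### Bundle charts: base and fibre coordinates on `E`. -/

section FibreCoordinates

variable {V : Type*} [NormedAddCommGroup V] [NormedSpace ℝ V]
  {H : Type*} [TopologicalSpace H] {I : ModelWithCorners ℝ V H}
  {M : Type*} [TopologicalSpace M] [ChartedSpace H M]
  {F : Type*} [NormedAddCommGroup F] {E : M → Type*}
  [TopologicalSpace (TotalSpace F E)] [∀ x, TopologicalSpace (E x)] [FiberBundle F E]

/-- The coordinate of a vector of `E m` in the preferred trivialization at `m₀`. -/
def fibreCoord (F : Type*) [NormedAddCommGroup F]
    {E : M → Type*} [TopologicalSpace (TotalSpace F E)] [∀ x, TopologicalSpace (E x)]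
    [FiberBundle F E] (m₀ : M) {m : M} (b : E m) : F :=
  (trivializationAt F E m₀ ⟨m, b⟩).2

variable (I F E) in
/-- The open set of base points over which the preferred bundle chart at a point over `m₀` is
defined. -/
def bundleChartDomain (m₀ : M) : Set M :=
  (trivializationAt F E m₀).baseSet ∩ (extChartAt I m₀).source

theorem mem_bundleChartDomain_self (m₀ : M) : m₀ ∈ bundleChartDomain I F E m₀ :=
  ⟨FiberBundle.mem_baseSet_trivializationAt' m₀, mem_extChartAt_source m₀⟩

theorem eventually_mem_bundleChartDomain {m₀ : M} {p : TotalSpace F E}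
    (hp : p.proj ∈ bundleChartDomain I F E m₀) :
    ∀ᶠ p' : TotalSpace F E in 𝓝 p, p'.proj ∈ bundleChartDomain I F E m₀ :=
  (FiberBundle.continuous_proj F E).continuousAt
    (((trivializationAt F E m₀).open_baseSet.inter (isOpen_extChartAt_source m₀)).mem_nhds hp)

variable [NormedSpace ℝ F]

theorem mem_extChartAt_bundle_source {a₀ p : TotalSpace F E} :
    p ∈ (extChartAt (I.prod 𝓘(ℝ, F)) a₀).source ↔ p.proj ∈ bundleChartDomain I F E a₀.proj := by
  rw [FiberBundle.extChartAt, PartialEquiv.trans_source, mem_inter_iff, mem_preimage]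
  have h : p ∈ (trivializationAt F E a₀.proj).toPartialEquiv.source ↔
      p.proj ∈ (trivializationAt F E a₀.proj).baseSet :=
    (trivializationAt F E a₀.proj).mem_source
  rw [h]
  refine and_congr_right fun hp ↦ ?_
  rw [PartialEquiv.prod_source]
  have h2 : (trivializationAt F E a₀.proj p).1 = p.proj :=
    (trivializationAt F E a₀.proj).coe_fst' hp
  constructor
  · intro h3
    exact h2 ▸ h3.1
  · intro h3
    exact ⟨h2.symm ▸ h3, mem_univ _⟩

theorem extChartAt_bundle {a₀ p : TotalSpace F E}
    (hp : p.proj ∈ bundleChartDomain I F E a₀.proj) :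
    extChartAt (I.prod 𝓘(ℝ, F)) a₀ p =
      (extChartAt I a₀.proj p.proj, fibreCoord F a₀.proj p.2) := by
  rw [FiberBundle.extChartAt]
  exact Prod.ext (congrArg (extChartAt I a₀.proj) ((trivializationAt F E a₀.proj).coe_fst' hp.1))
    rfl

variable [∀ x, AddCommMonoid (E x)] [∀ x, Module ℝ (E x)] [VectorBundle ℝ F E]

theorem fibreCoord_add {m₀ m : M} (hm : m ∈ (trivializationAt F E m₀).baseSet) (b b' : E m) :
    fibreCoord F m₀ (b + b') = fibreCoord F m₀ b + fibreCoord F m₀ b' :=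
  ((trivializationAt F E m₀).linear ℝ hm).map_add b b'

theorem fibreCoord_smul {m₀ m : M} (hm : m ∈ (trivializationAt F E m₀).baseSet) (r : ℝ) (b : E m) :
    fibreCoord F m₀ (r • b) = r • fibreCoord F m₀ b :=
  ((trivializationAt F E m₀).linear ℝ hm).map_smul r b

theorem fibreCoord_bijective {m₀ m : M} (hm : m ∈ (trivializationAt F E m₀).baseSet) :
    Function.Bijective (fibreCoord F m₀ : E m → F) := by
  have h := ((trivializationAt F E m₀).linearEquivAt ℝ m hm).bijective
  exact h

variable [IsManifold I ∞ M] [I.Boundaryless] [ContMDiffVectorBundle ∞ F E I]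

theorem chartDeriv_tangentProj {a₀ p : TotalSpace F E}
    (hp : p.proj ∈ bundleChartDomain I F E a₀.proj) (w : TangentSpace (I.prod 𝓘(ℝ, F)) p) :
    chartDeriv I a₀.proj p.proj (tangentProj I p w) = (chartDeriv (I.prod 𝓘(ℝ, F)) a₀ p w).1 := by
  refine chartDeriv_mfderiv (k := Prod.fst) (k' := ContinuousLinearMap.fst ℝ V F)
    (mem_extChartAt_bundle_source.2 hp) hasFDerivAt_fst ?_ ?_ w
  · filter_upwards [eventually_mem_bundleChartDomain hp] with p' hp'
    exact hp'.2
  · filter_upwards [eventually_mem_bundleChartDomain hp] with p' hp'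
    rw [extChartAt_bundle hp']

theorem hasDerivAt_add_smul_zero {G : Type*} [NormedAddCommGroup G] [NormedSpace ℝ G] (u b : G) :
    HasDerivAt (fun s : ℝ ↦ u + s • b) b 0 := by
  simpa using ((hasDerivAt_id (0 : ℝ)).smul_const b).const_add u

theorem chartDeriv_vertLift {a₀ a : TotalSpace F E}
    (ha : a.proj ∈ bundleChartDomain I F E a₀.proj) (b : E a.proj) :
    chartDeriv (I.prod 𝓘(ℝ, F)) a₀ a (vertLift I a b) = (0, fibreCoord F a₀.proj b) := by
  have h := (chartDeriv_mfderiv_curve (I := I.prod 𝓘(ℝ, F)) (x₀ := a₀)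
    (c := fun s : ℝ ↦ (⟨a.proj, a.2 + s • b⟩ : TotalSpace F E))
    ((hasDerivAt_const (0 : ℝ) (extChartAt I a₀.proj a.proj)).prodMk
      (hasDerivAt_add_smul_zero (fibreCoord F a₀.proj a.2) (fibreCoord F a₀.proj b)))
    (fun s ↦ mem_extChartAt_bundle_source.2 ha)
    (fun s ↦ by
      rw [extChartAt_bundle (p := ⟨a.proj, a.2 + s • b⟩) ha, fibreCoord_add ha.1, fibreCoord_smul ha.1])).2
  -- The curve starts at `a.2 + 0 • b`, which equals `a.2` only propositionally, so the derivative
  -- is moved to `a`.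
  have key : ∀ (x y : TotalSpace F E) (u : V × F), x = y →
      chartDeriv (I.prod 𝓘(ℝ, F)) a₀ x u = chartDeriv (I.prod 𝓘(ℝ, F)) a₀ y u := by
    rintro x _ u rfl
    rfl
  exact (key _ _ _ (by simp)).trans h

/-- The fibre coordinate of the connector. -/
theorem fibreCoord_connector {ξ : HorizontalLift I F E} {a₀ a : TotalSpace F E}
    (ha : a.proj ∈ bundleChartDomain I F E a₀.proj) (w : TangentSpace (I.prod 𝓘(ℝ, F)) a)
    (hw : (chartDeriv (I.prod 𝓘(ℝ, F)) a₀ a (vertProjector ξ a w)).1 = 0) :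
    fibreCoord F a₀.proj (connector ξ a w) =
      (chartDeriv (I.prod 𝓘(ℝ, F)) a₀ a (vertProjector ξ a w)).2 := by
  have hinj := (chartDeriv_bijective (mem_extChartAt_bundle_source.2 ha)).1
  obtain ⟨b, hb⟩ := (fibreCoord_bijective ha.1).2
    (chartDeriv (I.prod 𝓘(ℝ, F)) a₀ a (vertProjector ξ a w)).2
  -- `vertProj` is an `invFun`: it is determined because the vector is in the range of `vertLift`
  -- (by `hw`) and `vertLift` is injective (`h2`).
  have h1 : vertProjector ξ a w = vertLift I a b := by
    apply hinj
    rw [chartDeriv_vertLift ha, hb]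
    exact Prod.ext hw rfl
  have h2 : Function.Injective (vertLift I a) := by
    intro b b' h
    apply (fibreCoord_bijective ha.1).1
    have := congrArg (chartDeriv (I.prod 𝓘(ℝ, F)) a₀ a) h
    rw [chartDeriv_vertLift ha, chartDeriv_vertLift ha] at this
    exact (Prod.mk.inj this).2
  rw [← hb]
  congr 1
  rw [connector, vertProj, h1]
  exact Function.leftInverse_invFun h2 b

end FibreCoordinates

/-! ### Coordinates on `π^*E` and the operations of `Tπ : TE → TM`. -/

section PullbackCharts

set_option linter.unusedSectionVars false

variable {V : Type*} [NormedAddCommGroup V] [NormedSpace ℝ V]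
  {H : Type*} [TopologicalSpace H] {I : ModelWithCorners ℝ V H}
  {M : Type*} [TopologicalSpace M] [ChartedSpace H M] [IsManifold I ∞ M]
  {F : Type*} [NormedAddCommGroup F] [NormedSpace ℝ F]
  {E : M → Type*} [∀ x, AddCommMonoid (E x)] [∀ x, Module ℝ (E x)]
  [TopologicalSpace (TotalSpace F E)] [∀ x, TopologicalSpace (E x)] [FiberBundle F E]
  [VectorBundle ℝ F E] [ContMDiffVectorBundle ∞ F E I]

/-- The point `(a, a)` of `π^*E`. -/
def diag (I : ModelWithCorners ℝ V H) [IsManifold I ∞ M] [ContMDiffVectorBundle ∞ F E I]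
    (a : TotalSpace F E) : PullbackTotal I F E := ⟨a, a.2⟩

/-- The trivialization of `π^*E` at `a₀` is pulled back from that of `E` at `a₀.proj`, so its base
set already contains the domain of the chart of `E` at `a₀`. -/
theorem mem_bundleChartDomain_pullback {a₀ a : TotalSpace F E} :
    a ∈ bundleChartDomain (I.prod 𝓘(ℝ, F)) F (proj I F E *ᵖ E) a₀ ↔
      a.proj ∈ bundleChartDomain I F E a₀.proj := by
  rw [← mem_extChartAt_bundle_source]
  refine ⟨fun h ↦ h.2, fun h ↦ ⟨?_, h⟩⟩
  exact (mem_extChartAt_bundle_source.1 h).1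

theorem mem_extChartAt_pullback_source {a₀ : TotalSpace F E} {p : PullbackTotal I F E} :
    p ∈ (extChartAt ((I.prod 𝓘(ℝ, F)).prod 𝓘(ℝ, F)) (diag I a₀)).source ↔
      p.proj.proj ∈ bundleChartDomain I F E a₀.proj := by
  rw [mem_extChartAt_bundle_source]
  exact mem_bundleChartDomain_pullback

/-- The chart of `π^*E` depends only on the base point `a₀` of its centre; `diag` supplies one point
over it. The coordinates are those of `a` followed by the fibre coordinate of `b`. -/
theorem extChartAt_pullback {a₀ : TotalSpace F E} {p : PullbackTotal I F E}
    (hp : p.proj.proj ∈ bundleChartDomain I F E a₀.proj) :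
    extChartAt ((I.prod 𝓘(ℝ, F)).prod 𝓘(ℝ, F)) (diag I a₀) p =
      ((extChartAt I a₀.proj p.proj.proj, fibreCoord F a₀.proj p.proj.2),
        fibreCoord F a₀.proj (m := p.proj.proj) p.2) := by
  rw [extChartAt_bundle (mem_bundleChartDomain_pullback.2 hp), ← extChartAt_bundle hp]
  rfl

theorem eventually_mem_bundleChartDomain_pullback {m₀ : M} {p : PullbackTotal I F E}
    (hp : p.proj.proj ∈ bundleChartDomain I F E m₀) :
    ∀ᶠ p' : PullbackTotal I F E in 𝓝 p, p'.proj.proj ∈ bundleChartDomain I F E m₀ :=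
  (FiberBundle.continuous_proj F (proj I F E *ᵖ E)).continuousAt
    (eventually_mem_bundleChartDomain hp)

variable [I.Boundaryless]

theorem chartDeriv_pullback_proj {a₀ : TotalSpace F E} {p : PullbackTotal I F E}
    (hp : p.proj.proj ∈ bundleChartDomain I F E a₀.proj)
    (u : TangentSpace ((I.prod 𝓘(ℝ, F)).prod 𝓘(ℝ, F)) p) :
    chartDeriv (I.prod 𝓘(ℝ, F)) a₀ p.proj
      (mfderiv ((I.prod 𝓘(ℝ, F)).prod 𝓘(ℝ, F)) (I.prod 𝓘(ℝ, F))
          (TotalSpace.proj : PullbackTotal I F E → TotalSpace F E) p u) =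
      (chartDeriv ((I.prod 𝓘(ℝ, F)).prod 𝓘(ℝ, F)) (diag I a₀) p u).1 :=
  chartDeriv_tangentProj (a₀ := diag I a₀) (mem_bundleChartDomain_pullback.2 hp) u

theorem chartDeriv_pullback_lift {a₀ : TotalSpace F E} {p : PullbackTotal I F E}
    (hp : p.proj.proj ∈ bundleChartDomain I F E a₀.proj)
    (u : TangentSpace ((I.prod 𝓘(ℝ, F)).prod 𝓘(ℝ, F)) p) :
    chartDeriv (I.prod 𝓘(ℝ, F)) a₀ (Pullback.lift (proj I F E) p)
      (mfderiv ((I.prod 𝓘(ℝ, F)).prod 𝓘(ℝ, F)) (I.prod 𝓘(ℝ, F))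
          (Pullback.lift (proj I F E) : PullbackTotal I F E → TotalSpace F E) p u) =
      ((chartDeriv ((I.prod 𝓘(ℝ, F)).prod 𝓘(ℝ, F)) (diag I a₀) p u).1.1,
        (chartDeriv ((I.prod 𝓘(ℝ, F)).prod 𝓘(ℝ, F)) (diag I a₀) p u).2) := by
  refine chartDeriv_mfderiv (k := fun z : (V × F) × F ↦ (z.1.1, z.2))
    (x₀' := diag I a₀)
    (k' := ((ContinuousLinearMap.fst ℝ V F).comp (ContinuousLinearMap.fst ℝ (V × F) F)).prod
      (ContinuousLinearMap.snd ℝ (V × F) F))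
    (mem_extChartAt_pullback_source.2 hp)
    (hasFDerivAt_fst.fst.prodMk hasFDerivAt_snd) ?_ ?_ u
  · filter_upwards [eventually_mem_bundleChartDomain_pullback hp] with p' hp'
    exact mem_extChartAt_bundle_source.2 hp'
  · filter_upwards [eventually_mem_bundleChartDomain_pullback hp] with p' hp'
    rw [extChartAt_pullback hp']
    exact extChartAt_bundle (p := Pullback.lift (proj I F E) p') hp'

/-- The tangent vectors to `π^*E` are the pairs of tangent vectors with the same projection. -/
theorem chartDeriv_pairTangent {a₀ : TotalSpace F E} {p : PullbackTotal I F E}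
    (hp : p.proj.proj ∈ bundleChartDomain I F E a₀.proj)
    (w₁ : TangentSpace (I.prod 𝓘(ℝ, F)) p.proj)
    (w₂ : TangentSpace (I.prod 𝓘(ℝ, F)) (Pullback.lift (proj I F E) p))
    (h : (chartDeriv (I.prod 𝓘(ℝ, F)) a₀ p.proj w₁).1 =
      (chartDeriv (I.prod 𝓘(ℝ, F)) a₀ (Pullback.lift (proj I F E) p) w₂).1) :
    chartDeriv ((I.prod 𝓘(ℝ, F)).prod 𝓘(ℝ, F)) (diag I a₀) p (pairTangent I p w₁ w₂) =
      (chartDeriv (I.prod 𝓘(ℝ, F)) a₀ p.proj w₁,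
        (chartDeriv (I.prod 𝓘(ℝ, F)) a₀ (Pullback.lift (proj I F E) p) w₂).2) := by
  obtain ⟨u, hu⟩ := (chartDeriv_bijective (mem_extChartAt_pullback_source.2 hp)).2
    (chartDeriv (I.prod 𝓘(ℝ, F)) a₀ p.proj w₁,
        (chartDeriv (I.prod 𝓘(ℝ, F)) a₀ (Pullback.lift (proj I F E) p) w₂).2)
  have h1 := chartDeriv_pullback_proj hp u
  have h2 := chartDeriv_pullback_lift hp u
  rw [hu] at h1 h2
  have i1 := (chartDeriv_bijective (I := I.prod 𝓘(ℝ, F)) (x₀ := a₀) (x := p.proj)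
    (mem_extChartAt_bundle_source.2 hp)).1 h1
  have i2 := (chartDeriv_bijective (I := I.prod 𝓘(ℝ, F)) (x₀ := a₀)
    (x := Pullback.lift (proj I F E) p)
    (mem_extChartAt_bundle_source.2 hp)).1 (h2.trans (Prod.ext h rfl))
  have hex := Function.invFun_eq (b := (w₁, w₂))
    (f := fun u : TangentSpace ((I.prod 𝓘(ℝ, F)).prod 𝓘(ℝ, F)) p ↦
      ((mfderiv ((I.prod 𝓘(ℝ, F)).prod 𝓘(ℝ, F)) (I.prod 𝓘(ℝ, F))
          (TotalSpace.proj : PullbackTotal I F E → TotalSpace F E) p u,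
        mfderiv ((I.prod 𝓘(ℝ, F)).prod 𝓘(ℝ, F)) (I.prod 𝓘(ℝ, F))
          (Pullback.lift (proj I F E) : PullbackTotal I F E → TotalSpace F E) p u) :
        TangentSpace (I.prod 𝓘(ℝ, F)) p.proj ×
          TangentSpace (I.prod 𝓘(ℝ, F)) (Pullback.lift (proj I F E) p)))
    ⟨u, Prod.ext i1 i2⟩
  obtain ⟨e1, e2⟩ := Prod.mk.inj hex
  have f1 := chartDeriv_pullback_proj hp (pairTangent I p w₁ w₂)
  have f2 := chartDeriv_pullback_lift hp (pairTangent I p w₁ w₂)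
  refine Prod.ext ?_ ?_
  · rw [← f1]
    exact congrArg (chartDeriv (I.prod 𝓘(ℝ, F)) a₀ p.proj) e1
  · have := f2.symm.trans
      (congrArg (chartDeriv (I.prod 𝓘(ℝ, F)) a₀ (Pullback.lift (proj I F E) p)) e2)
    exact (Prod.ext_iff.1 this).2

/-- In a bundle chart the fibre operations are linear in the fibre coordinates and fix the base
coordinate, so their tangent maps have the same form. The same reason gives `chartDeriv_tauAdd`. -/
theorem chartDeriv_tauSMul {a₀ : TotalSpace F E} {m : M}
    (hm : m ∈ bundleChartDomain I F E a₀.proj) (r : ℝ) (b : E m)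
    (w : TangentSpace (I.prod 𝓘(ℝ, F)) (⟨m, b⟩ : TotalSpace F E)) :
    chartDeriv (I.prod 𝓘(ℝ, F)) a₀ ⟨m, r • b⟩ (tauSMul I r b w) =
      ((chartDeriv (I.prod 𝓘(ℝ, F)) a₀ ⟨m, b⟩ w).1,
        r • (chartDeriv (I.prod 𝓘(ℝ, F)) a₀ ⟨m, b⟩ w).2) := by
  refine chartDeriv_mfderiv (k := fun z : V × F ↦ (z.1, r • z.2)) (x₀' := a₀)
    (p := (⟨m, b⟩ : TotalSpace F E))
    (f := fun e : TotalSpace F E ↦ (⟨e.proj, r • e.2⟩ : TotalSpace F E))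
    (k' := (ContinuousLinearMap.fst ℝ V F).prod (r • ContinuousLinearMap.snd ℝ V F))
    (mem_extChartAt_bundle_source.2 hm)
    (hasFDerivAt_fst.prodMk (hasFDerivAt_snd.const_smul r)) ?_ ?_ w
  · filter_upwards [eventually_mem_bundleChartDomain (p := (⟨m, b⟩ : TotalSpace F E)) hm]
      with p' hp'
    exact mem_extChartAt_bundle_source.2 hp'
  · filter_upwards [eventually_mem_bundleChartDomain (p := (⟨m, b⟩ : TotalSpace F E)) hm]
      with p' hp'
    rw [extChartAt_bundle hp', extChartAt_bundle (p := ⟨p'.proj, r • p'.2⟩) hp',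
      fibreCoord_smul hp'.1]

theorem chartDeriv_tauAdd {a₀ : TotalSpace F E} {m : M}
    (hm : m ∈ bundleChartDomain I F E a₀.proj) (a b : E m)
    (w₁ : TangentSpace (I.prod 𝓘(ℝ, F)) (⟨m, a⟩ : TotalSpace F E))
    (w₂ : TangentSpace (I.prod 𝓘(ℝ, F)) (⟨m, b⟩ : TotalSpace F E))
    (h : (chartDeriv (I.prod 𝓘(ℝ, F)) a₀ ⟨m, a⟩ w₁).1 =
      (chartDeriv (I.prod 𝓘(ℝ, F)) a₀ ⟨m, b⟩ w₂).1) :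
    chartDeriv (I.prod 𝓘(ℝ, F)) a₀ ⟨m, a + b⟩ (tauAdd I a b w₁ w₂) =
      ((chartDeriv (I.prod 𝓘(ℝ, F)) a₀ ⟨m, a⟩ w₁).1,
        (chartDeriv (I.prod 𝓘(ℝ, F)) a₀ ⟨m, a⟩ w₁).2 +
          (chartDeriv (I.prod 𝓘(ℝ, F)) a₀ ⟨m, b⟩ w₂).2) := by
  have h1 := chartDeriv_mfderiv (k := fun z : (V × F) × F ↦ (z.1.1, z.1.2 + z.2))
    (x₀ := a₀) (x₀' := diag I a₀)
    (p := (⟨⟨m, a⟩, b⟩ : PullbackTotal I F E))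
    (f := fun q : PullbackTotal I F E ↦
      let c : E q.proj.proj := q.2
      (⟨q.proj.proj, q.proj.2 + c⟩ : TotalSpace F E))
    (k' := ((ContinuousLinearMap.fst ℝ V F).comp (ContinuousLinearMap.fst ℝ (V × F) F)).prod
      ((ContinuousLinearMap.snd ℝ V F).comp (ContinuousLinearMap.fst ℝ (V × F) F) +
        ContinuousLinearMap.snd ℝ (V × F) F))
    (mem_extChartAt_pullback_source.2 hm)
    (hasFDerivAt_fst.fst.prodMk (hasFDerivAt_fst.snd.add hasFDerivAt_snd))
    (by
      filter_upwards [eventually_mem_bundleChartDomain_pullback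
        (p := (⟨⟨m, a⟩, b⟩ : PullbackTotal I F E)) hm] with p' hp'
      exact mem_extChartAt_bundle_source.2 hp')
    (by
      filter_upwards [eventually_mem_bundleChartDomain_pullback
        (p := (⟨⟨m, a⟩, b⟩ : PullbackTotal I F E)) hm] with p' hp'
      let c : E p'.proj.proj := p'.2
      rw [extChartAt_pullback hp', extChartAt_bundle (p := ⟨p'.proj.proj, p'.proj.2 + c⟩) hp']
      exact Prod.ext rfl (fibreCoord_add hp'.1 _ _))
    (pairTangent I ⟨⟨m, a⟩, b⟩ w₁ w₂)
  refine h1.trans ?_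
  have h2 := chartDeriv_pairTangent (p := (⟨⟨m, a⟩, b⟩ : PullbackTotal I F E)) hm w₁ w₂ h
  rw [h2]
  rfl

end PullbackCharts

/-! ### Local form of a connection, of its connector and of its linearization. -/

section LocalForm

variable {V : Type*} [NormedAddCommGroup V] [NormedSpace ℝ V]
  {H : Type*} [TopologicalSpace H] {I : ModelWithCorners ℝ V H}
  {M : Type*} [TopologicalSpace M] [ChartedSpace H M] [IsManifold I ∞ M]
  {F : Type*} [NormedAddCommGroup F] [NormedSpace ℝ F]
  {E : M → Type*} [∀ x, AddCommMonoid (E x)] [∀ x, Module ℝ (E x)]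
  [TopologicalSpace (TotalSpace F E)] [∀ x, TopologicalSpace (E x)] [FiberBundle F E]
  [VectorBundle ℝ F E] [ContMDiffVectorBundle ∞ F E I]

/-- This reconciles the two coordinates on `TM`: the bundle trivialization, which enters the chart
of `π^*TM`, and the derivative of the chart of `M`. -/
theorem fibreCoord_tangent {m₀ m : M} (hm : m ∈ (extChartAt I m₀).source) (v : TangentSpace I m) :
    fibreCoord V (E := (TangentSpace I : M → Type _)) m₀ v = chartDeriv I m₀ m v :=
  congrArg Prod.snd (extChartAt_tangentBundle (I := I) (q := ⟨m₀, 0⟩) (z := ⟨m, v⟩) hm)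

/-- The base point of the chart of `π^*TM` used at `a₀`. -/
def zeroLift (I : ModelWithCorners ℝ V H) [IsManifold I ∞ M] [ContMDiffVectorBundle ∞ F E I]
    (a₀ : TotalSpace F E) : TotalSpace V (proj I F E *ᵖ (TangentSpace I : M → Type _)) :=
  ⟨a₀, (0 : TangentSpace I a₀.proj)⟩

theorem mem_extChartAt_zeroLift_source {a₀ : TotalSpace F E}
    {p : TotalSpace V (proj I F E *ᵖ (TangentSpace I : M → Type _))} :
    p ∈ (extChartAt ((I.prod 𝓘(ℝ, F)).prod 𝓘(ℝ, V)) (zeroLift I a₀)).source ↔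
      p.proj.proj ∈ bundleChartDomain I F E a₀.proj := by
  rw [mem_extChartAt_bundle_source]
  refine ⟨fun h ↦ mem_extChartAt_bundle_source.1 h.2,
    fun h ↦ ⟨?_, mem_extChartAt_bundle_source.2 h⟩⟩
  have := h.2
  rw [extChartAt_source, ← TangentBundle.trivializationAt_baseSet (I := I)] at this
  exact this

theorem extChartAt_zeroLift {a₀ : TotalSpace F E}
    {p : TotalSpace V (proj I F E *ᵖ (TangentSpace I : M → Type _))}
    (hp : p.proj.proj ∈ bundleChartDomain I F E a₀.proj) :
    extChartAt ((I.prod 𝓘(ℝ, F)).prod 𝓘(ℝ, V)) (zeroLift I a₀) p =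
      (extChartAt (I.prod 𝓘(ℝ, F)) a₀ p.proj, chartDeriv I a₀.proj p.proj.proj p.2) := by
  rw [extChartAt_bundle (mem_extChartAt_bundle_source.1 (mem_extChartAt_zeroLift_source.2 hp))]
  exact Prod.ext rfl (fibreCoord_tangent (m := p.proj.proj) hp.2 p.2)

/-- The local form of a horizontal lift: `ξ (x, u) v = (v, liftCoord ((x, u), v))` in the chart at
`a₀`. -/
def liftCoord (ξ : HorizontalLift I F E) (a₀ : TotalSpace F E) (z : (V × F) × V) : F :=
  let p := (extChartAt ((I.prod 𝓘(ℝ, F)).prod 𝓘(ℝ, V)) (zeroLift I a₀)).symm z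
  (extChartAt (I.prod 𝓘(ℝ, F)).tangent
    (⟨a₀, 0⟩ : TangentBundle (I.prod 𝓘(ℝ, F)) (TotalSpace F E)) ⟨p.proj, ξ p.proj p.2⟩).2.2

theorem liftCoord_apply (ξ : HorizontalLift I F E) {a₀ a : TotalSpace F E}
    (ha : a.proj ∈ bundleChartDomain I F E a₀.proj) (v : TangentSpace I a.proj) :
    liftCoord ξ a₀ (extChartAt (I.prod 𝓘(ℝ, F)) a₀ a, chartDeriv I a₀.proj a.proj v) =
      (chartDeriv (I.prod 𝓘(ℝ, F)) a₀ a (ξ a v)).2 := by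
  let p : TotalSpace V (proj I F E *ᵖ (TangentSpace I : M → Type _)) := ⟨a, v⟩
  have h1 := (extChartAt ((I.prod 𝓘(ℝ, F)).prod 𝓘(ℝ, V)) (zeroLift I a₀)).left_inv
    ((mem_extChartAt_zeroLift_source (p := p)).2 ha)
  rw [extChartAt_zeroLift (p := p) ha] at h1
  unfold liftCoord
  rw [h1]
  exact congrArg (fun z : (V × F) × (V × F) ↦ z.2.2)
    (extChartAt_tangentBundle (q := ⟨a₀, 0⟩) (z := ⟨a, ξ a v⟩) (mem_extChartAt_bundle_source.2 ha))

/-- Every vector of `V` is the coordinate of a tangent vector, so fibrewise linearity of `ξ` passes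
to the local form. It is what cancels the derivatives of `W` in the bracket. -/
theorem isLinearMap_liftCoord {ξ : HorizontalLift I F E} (hξ : IsEhresmannConnection ξ)
    {a₀ a : TotalSpace F E} (ha : a.proj ∈ bundleChartDomain I F E a₀.proj) :
    IsLinearMap ℝ (fun w ↦ liftCoord ξ a₀ (extChartAt (I.prod 𝓘(ℝ, F)) a₀ a, w)) := by
  have hs := (chartDeriv_bijective (I := I) ha.2).2
  constructor
  · intro w w'
    obtain ⟨v, rfl⟩ := hs w
    obtain ⟨v', rfl⟩ := hs w'
    rw [← map_add, liftCoord_apply ξ ha, liftCoord_apply ξ ha, liftCoord_apply ξ ha,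
      (hξ.isLinearMap a).map_add, map_add]
    rfl
  · intro r w
    obtain ⟨v, rfl⟩ := hs w
    rw [← map_smul, liftCoord_apply ξ ha, liftCoord_apply ξ ha,
      (hξ.isLinearMap a).map_smul, map_smul]
    rfl

variable [I.Boundaryless]

theorem chartDeriv_lift {ξ : HorizontalLift I F E} (hξ : IsEhresmannConnection ξ)
    {a₀ a : TotalSpace F E}
    (ha : a.proj ∈ bundleChartDomain I F E a₀.proj) (v : TangentSpace I a.proj) :
    chartDeriv (I.prod 𝓘(ℝ, F)) a₀ a (ξ a v) = (chartDeriv I a₀.proj a.proj v,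
      liftCoord ξ a₀ (extChartAt (I.prod 𝓘(ℝ, F)) a₀ a, chartDeriv I a₀.proj a.proj v)) := by
  refine Prod.ext ?_ (liftCoord_apply ξ ha v).symm
  rw [← chartDeriv_tangentProj ha, hξ.tangentProj_lift]

/-- Joint differentiability in the point and the velocity comes from reading `hξ.smooth` in the
charts of `π^*TM` and `TE`. -/
theorem differentiableAt_liftCoord {ξ : HorizontalLift I F E} (hξ : IsEhresmannConnection ξ)
    {a₀ a : TotalSpace F E} (ha : a.proj ∈ bundleChartDomain I F E a₀.proj) (w : V) :
    DifferentiableAt ℝ (liftCoord ξ a₀) (extChartAt (I.prod 𝓘(ℝ, F)) a₀ a, w) := by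
  obtain ⟨v, rfl⟩ := (chartDeriv_bijective (I := I) ha.2).2 w
  let p : TotalSpace V (proj I F E *ᵖ (TangentSpace I : M → Type _)) := ⟨a, v⟩
  have hp := (mem_extChartAt_zeroLift_source (p := p)).2 ha
  have hl := (extChartAt ((I.prod 𝓘(ℝ, F)).prod 𝓘(ℝ, V)) (zeroLift I a₀)).left_inv hp
  have ht := (extChartAt ((I.prod 𝓘(ℝ, F)).prod 𝓘(ℝ, V)) (zeroLift I a₀)).map_source hp
  rw [extChartAt_zeroLift (p := p) ha] at hl ht
  let q : TangentBundle (I.prod 𝓘(ℝ, F)) (TotalSpace F E) := ⟨a₀, 0⟩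
  have h1 := mdifferentiableAt_extChartAt_symm ht
  have h2 := (hξ.smooth p).mdifferentiableAt (by simp)
  have h3 : MDifferentiableAt (I.prod 𝓘(ℝ, F)).tangent 𝓘(ℝ, (V × F) × (V × F))
      (extChartAt (I.prod 𝓘(ℝ, F)).tangent q) ⟨a, ξ a v⟩ :=
    mdifferentiableAt_extChartAt (by
      have := (mem_extChartAt_tangentBundle_source (q := q) (z := ⟨a, ξ a v⟩)).2
        (mem_extChartAt_bundle_source.2 ha)
      rwa [extChartAt_source] at this)
  have h4 := h3.comp_of_eq _ (h2.comp_of_eq _ h1 hl)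
    (congrArg (fun p : TotalSpace V (proj I F E *ᵖ (TangentSpace I : M → Type _)) ↦
      (⟨p.proj, ξ p.proj p.2⟩ : TangentBundle (I.prod 𝓘(ℝ, F)) (TotalSpace F E))) hl)
  exact (MDifferentiableAt.differentiableAt h4).snd.snd

theorem chartDeriv_vertProjector {ξ : HorizontalLift I F E} (hξ : IsEhresmannConnection ξ)
    {a₀ a : TotalSpace F E}
    (ha : a.proj ∈ bundleChartDomain I F E a₀.proj) (w : TangentSpace (I.prod 𝓘(ℝ, F)) a) :
    chartDeriv (I.prod 𝓘(ℝ, F)) a₀ a (vertProjector ξ a w) =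
      (0, (chartDeriv (I.prod 𝓘(ℝ, F)) a₀ a w).2 -
        liftCoord ξ a₀ (extChartAt (I.prod 𝓘(ℝ, F)) a₀ a,
          (chartDeriv (I.prod 𝓘(ℝ, F)) a₀ a w).1)) := by
  rw [vertProjector, horProjector, map_sub, chartDeriv_lift hξ ha, chartDeriv_tangentProj ha]
  exact Prod.ext (sub_self _) rfl

/-- The local form of the connector. -/
theorem fibreCoord_connector_eq {ξ : HorizontalLift I F E} (hξ : IsEhresmannConnection ξ)
    {a₀ a : TotalSpace F E}
    (ha : a.proj ∈ bundleChartDomain I F E a₀.proj) (w : TangentSpace (I.prod 𝓘(ℝ, F)) a) :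
    fibreCoord F a₀.proj (connector ξ a w) =
      (chartDeriv (I.prod 𝓘(ℝ, F)) a₀ a w).2 -
        liftCoord ξ a₀ (extChartAt (I.prod 𝓘(ℝ, F)) a₀ a,
          (chartDeriv (I.prod 𝓘(ℝ, F)) a₀ a w).1) := by
  have h := chartDeriv_vertProjector hξ ha w
  rw [fibreCoord_connector ha w (by rw [h]), h]

/-- The local form of the linearization of a connection. -/
theorem chartDeriv_linearizationB {ξ : HorizontalLift I F E} (hξ : IsEhresmannConnection ξ)
    {a₀ : TotalSpace F E} {m : M}
    (hm : m ∈ bundleChartDomain I F E a₀.proj) (a b : E m)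
    (w : TangentSpace (I.prod 𝓘(ℝ, F)) (⟨m, a⟩ : TotalSpace F E)) :
    chartDeriv (I.prod 𝓘(ℝ, F)) a₀ ⟨m, b⟩ (linearizationB ξ a b w) =
      ((chartDeriv (I.prod 𝓘(ℝ, F)) a₀ ⟨m, a⟩ w).1,
        fderiv ℝ (liftCoord ξ a₀) (extChartAt (I.prod 𝓘(ℝ, F)) a₀ ⟨m, a⟩,
          (chartDeriv (I.prod 𝓘(ℝ, F)) a₀ ⟨m, a⟩ w).1)
          ((0, fibreCoord F a₀.proj b), 0)) := by
  have hmem : ∀ b : E m, (⟨m, b⟩ : TotalSpace F E).proj ∈ bundleChartDomain I F E a₀.proj :=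
    fun _ ↦ hm
  set x := (chartDeriv (I.prod 𝓘(ℝ, F)) a₀ ⟨m, a⟩ w).1 with hx
  set y := extChartAt (I.prod 𝓘(ℝ, F)) a₀ ⟨m, a⟩ with hy
  set β := fibreCoord F a₀.proj b with hβ
  set d := fderiv ℝ (liftCoord ξ a₀) (y, x) ((0, β), 0) with hd
  let v : TangentSpace I m := tangentProj I (⟨m, a⟩ : TotalSpace F E) w
  have hv : chartDeriv I a₀.proj m v = x := chartDeriv_tangentProj (hmem a) w
  let q : TangentBundle (I.prod 𝓘(ℝ, F)) (TotalSpace F E) := ⟨a₀, 0⟩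
  have hye : ∀ s : ℝ, extChartAt (I.prod 𝓘(ℝ, F)) a₀ (⟨m, a + s • b⟩ : TotalSpace F E) =
      y + s • ((0, β) : V × F) := by
    intro s
    rw [extChartAt_bundle (hmem _), hy, extChartAt_bundle (hmem _), fibreCoord_add hm.1,
      fibreCoord_smul hm.1]
    exact Prod.ext (by simp) rfl
  -- Once `w'` has the right base velocity, the equation in `T(TE)` defining `B` reduces to a single
  -- equation on its fibre coordinate.
  have key : ∀ w' : TangentSpace (I.prod 𝓘(ℝ, F)) (⟨m, b⟩ : TotalSpace F E),
      (chartDeriv (I.prod 𝓘(ℝ, F)) a₀ ⟨m, b⟩ w').1 = x →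
      (vertLiftT I a b (ξ ⟨m, a⟩ v) w' = velocity (I.prod 𝓘(ℝ, F)).tangent
        (fun s : ℝ ↦ (⟨⟨m, a + s • b⟩, ξ ⟨m, a + s • b⟩ v⟩ :
          TangentBundle (I.prod 𝓘(ℝ, F)) (TotalSpace F E))) ↔
        (chartDeriv (I.prod 𝓘(ℝ, F)) a₀ ⟨m, b⟩ w').2 = d) := by
    intro w' hw'
    set γ := (chartDeriv (I.prod 𝓘(ℝ, F)) a₀ ⟨m, b⟩ w').2 with hγ
    -- In the chart of `TE` the first curve is affine, with fibre velocity `liftCoord ξ a₀ (y, x) +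
    -- s • γ`; the second differs only there, having `liftCoord ξ a₀ (y + s • (0, β), x)`.
    have hc₁ := (hasDerivAt_add_smul_zero y ((0, β) : V × F)).prodMk
      ((hasDerivAt_const (0 : ℝ) x).prodMk (hasDerivAt_add_smul_zero (liftCoord ξ a₀ (y, x)) γ))
    have hl : HasDerivAt (fun s : ℝ ↦ liftCoord ξ a₀ (y + s • ((0, β) : V × F), x)) d 0 := by
      have hf : HasFDerivAt (liftCoord ξ a₀) (fderiv ℝ (liftCoord ξ a₀) (y, x))
          (y + (0 : ℝ) • ((0, β) : V × F), x) := by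
        rw [zero_smul, add_zero]
        exact (differentiableAt_liftCoord hξ (hmem a) x).hasFDerivAt
      exact hf.comp_hasDerivAt (0 : ℝ)
        ((hasDerivAt_add_smul_zero y ((0, β) : V × F)).prodMk (hasDerivAt_const (0 : ℝ) x))
    have hc₂ := (hasDerivAt_add_smul_zero y ((0, β) : V × F)).prodMk
      ((hasDerivAt_const (0 : ℝ) x).prodMk hl)
    have h := velocity_eq_iff (I := (I.prod 𝓘(ℝ, F)).tangent) (x₀ := q)
      (c₁ := fun s : ℝ ↦ (⟨⟨m, a + s • b⟩, tauAdd I a (s • b) (ξ ⟨m, a⟩ v) (tauSMul I s b w')⟩ :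
        TangentBundle (I.prod 𝓘(ℝ, F)) (TotalSpace F E)))
      (c₂ := fun s : ℝ ↦ (⟨⟨m, a + s • b⟩, ξ ⟨m, a + s • b⟩ v⟩ :
          TangentBundle (I.prod 𝓘(ℝ, F)) (TotalSpace F E))) hc₁ hc₂
      (fun s ↦ mem_extChartAt_tangentBundle_source.2 (mem_extChartAt_bundle_source.2 hm))
      (fun s ↦ mem_extChartAt_tangentBundle_source.2 (mem_extChartAt_bundle_source.2 hm))
      (fun s ↦ by
        rw [extChartAt_tangentBundle (mem_extChartAt_bundle_source.2 hm)]
        refine Prod.ext (hye s) ?_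
        have e1 := chartDeriv_tauSMul hm s b w'
        have e2 := chartDeriv_lift hξ (hmem a) v
        rw [hv] at e2
        have e3 := chartDeriv_tauAdd hm a (s • b) (ξ ⟨m, a⟩ v) (tauSMul I s b w')
          (by rw [e1, e2, hw'])
        rw [e1, e2] at e3
        exact e3)
      (fun s ↦ by
        rw [extChartAt_tangentBundle (mem_extChartAt_bundle_source.2 hm)]
        refine Prod.ext (hye s) ?_
        have e2 := chartDeriv_lift hξ (hmem (a + s • b)) v
        rw [hv, hye s] at e2
        exact e2)
    refine h.trans ⟨fun h ↦ (Prod.ext_iff.1 (Prod.ext_iff.1 h.2).2).2, fun h ↦ ⟨?_, ?_⟩⟩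
    · simp
    · rw [h]
  have hbij := chartDeriv_bijective (I := I.prod 𝓘(ℝ, F)) (x₀ := a₀)
    (mem_extChartAt_bundle_source.2 (hmem b))
  have hproj : ∀ w' : TangentSpace (I.prod 𝓘(ℝ, F)) (⟨m, b⟩ : TotalSpace F E),
      tangentProj I (⟨m, b⟩ : TotalSpace F E) w' = v ↔
        (chartDeriv (I.prod 𝓘(ℝ, F)) a₀ ⟨m, b⟩ w').1 = x := by
    intro w'
    rw [← chartDeriv_tangentProj (hmem b), ← hv]
    exact ((chartDeriv_bijective (I := I) hm.2).1.eq_iff).symm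
  -- `Classical.epsilon` satisfies its property only if some vector does; the one with coordinates
  -- `(x, d)` does.
  have hex : ∃ w' : TangentSpace (I.prod 𝓘(ℝ, F)) (⟨m, b⟩ : TotalSpace F E),
      tangentProj I (⟨m, b⟩ : TotalSpace F E) w' = v ∧
      vertLiftT I a b (ξ ⟨m, a⟩ v) w' = velocity (I.prod 𝓘(ℝ, F)).tangent
        (fun s : ℝ ↦ (⟨⟨m, a + s • b⟩, ξ ⟨m, a + s • b⟩ v⟩ :
          TangentBundle (I.prod 𝓘(ℝ, F)) (TotalSpace F E))) := by
    obtain ⟨w', hw'⟩ := hbij.2 (x, d)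
    have h1 : (chartDeriv (I.prod 𝓘(ℝ, F)) a₀ ⟨m, b⟩ w').1 = x := by rw [hw']
    exact ⟨w', (hproj w').2 h1, (key w' h1).2 (by rw [hw'])⟩
  have hspec := Classical.epsilon_spec hex
  have h1 := (hproj _).1 hspec.1
  exact Prod.ext h1 ((key _ h1).1 hspec.2)

end LocalForm

/-! ### Local forms of the covariant derivative and of the bracket term. -/

section CovariantDerivative

variable {V : Type*} [NormedAddCommGroup V] [NormedSpace ℝ V]
  {H : Type*} [TopologicalSpace H] {I : ModelWithCorners ℝ V H} [I.Boundaryless]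
  {M : Type*} [TopologicalSpace M] [ChartedSpace H M] [IsManifold I ∞ M]
  {F : Type*} [NormedAddCommGroup F] [NormedSpace ℝ F]
  {E : M → Type*} [∀ x, AddCommMonoid (E x)] [∀ x, Module ℝ (E x)]
  [TopologicalSpace (TotalSpace F E)] [∀ x, TopologicalSpace (E x)] [FiberBundle F E]
  [VectorBundle ℝ F E] [ContMDiffVectorBundle ∞ F E I]

/-- The local form in the chart at `a₀` of a section of `E` along `π`. -/
def sectionCoord (I : ModelWithCorners ℝ V H) (a₀ : TotalSpace F E)
    (σ : (a : TotalSpace F E) → E a.proj) (y : V × F) : F :=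
  fibreCoord F a₀.proj (σ ((extChartAt (I.prod 𝓘(ℝ, F)) a₀).symm y))

omit [I.Boundaryless] [IsManifold I ∞ M] [∀ x, AddCommMonoid (E x)] [∀ x, Module ℝ (E x)]
  [VectorBundle ℝ F E] [ContMDiffVectorBundle ∞ F E I] in
theorem sectionCoord_extChartAt {a₀ a : TotalSpace F E} (σ : (a : TotalSpace F E) → E a.proj)
    (ha : a.proj ∈ bundleChartDomain I F E a₀.proj) :
    sectionCoord I a₀ σ (extChartAt (I.prod 𝓘(ℝ, F)) a₀ a) = fibreCoord F a₀.proj (σ a) := by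
  unfold sectionCoord
  rw [(extChartAt (I.prod 𝓘(ℝ, F)) a₀).left_inv (mem_extChartAt_bundle_source.2 ha)]

theorem differentiableAt_sectionCoord {σ : (a : TotalSpace F E) → E a.proj}
    (hσ : ContMDiff (I.prod 𝓘(ℝ, F)) (I.prod 𝓘(ℝ, F)) ∞
      (fun a : TotalSpace F E ↦ (⟨a.proj, σ a⟩ : TotalSpace F E)))
    (a : TotalSpace F E) :
    DifferentiableAt ℝ (sectionCoord I a σ) (extChartAt (I.prod 𝓘(ℝ, F)) a a) := by
  have h1 := mdifferentiableAt_extChartAt_symm (mem_extChartAt_target (I := I.prod 𝓘(ℝ, F)) a)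
  have h2 := (hσ a).mdifferentiableAt (by simp)
  have h3 : MDifferentiableAt (I.prod 𝓘(ℝ, F)) 𝓘(ℝ, V × F) (extChartAt (I.prod 𝓘(ℝ, F)) a)
      ⟨a.proj, σ a⟩ :=
    mdifferentiableAt_extChartAt (by
      have := (mem_extChartAt_bundle_source (I := I) (a₀ := a) (p := ⟨a.proj, σ a⟩)).2
        (mem_bundleChartDomain_self a.proj)
      rwa [extChartAt_source] at this)
  have hl := extChartAt_to_inv (I := I.prod 𝓘(ℝ, F)) a
  have h4 := h3.comp_of_eq _ (h2.comp_of_eq _ h1 hl)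
    (congrArg (fun a : TotalSpace F E ↦ (⟨a.proj, σ a⟩ : TotalSpace F E)) hl)
  have h5 : DifferentiableAt ℝ _ _ := (MDifferentiableAt.differentiableAt h4).snd
  refine h5.congr_of_eventuallyEq ?_
  filter_upwards [extChartAt_target_mem_nhds (I := I.prod 𝓘(ℝ, F)) a] with y hy
  have hy' := mem_extChartAt_bundle_source.1 ((extChartAt (I.prod 𝓘(ℝ, F)) a).map_target hy)
  exact (congrArg Prod.snd (extChartAt_bundle (I := I) (a₀ := a)
    (p := ⟨((extChartAt (I.prod 𝓘(ℝ, F)) a).symm y).proj,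
      σ ((extChartAt (I.prod 𝓘(ℝ, F)) a).symm y)⟩) hy')).symm

theorem chartDeriv_mfderiv_section {σ : (a : TotalSpace F E) → E a.proj}
    (hσ : ContMDiff (I.prod 𝓘(ℝ, F)) (I.prod 𝓘(ℝ, F)) ∞
      (fun a : TotalSpace F E ↦ (⟨a.proj, σ a⟩ : TotalSpace F E)))
    (a : TotalSpace F E) (w : TangentSpace (I.prod 𝓘(ℝ, F)) a) :
    chartDeriv (I.prod 𝓘(ℝ, F)) a ⟨a.proj, σ a⟩
      (mfderiv (I.prod 𝓘(ℝ, F)) (I.prod 𝓘(ℝ, F))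
        (fun e : TotalSpace F E ↦ (⟨e.proj, σ e⟩ : TotalSpace F E)) a w) =
      ((chartDeriv (I.prod 𝓘(ℝ, F)) a a w).1,
        fderiv ℝ (sectionCoord I a σ) (extChartAt (I.prod 𝓘(ℝ, F)) a a)
          (chartDeriv (I.prod 𝓘(ℝ, F)) a a w)) := by
  have ha := mem_bundleChartDomain_self (I := I) (F := F) (E := E) a.proj
  refine chartDeriv_mfderiv (x₀' := a) (p := a)
    (f := fun e : TotalSpace F E ↦ (⟨e.proj, σ e⟩ : TotalSpace F E))
    (k := fun y : V × F ↦ (y.1, sectionCoord I a σ y))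
    (k' := (ContinuousLinearMap.fst ℝ V F).prod (fderiv ℝ (sectionCoord I a σ) _))
    (mem_extChartAt_source a)
    (hasFDerivAt_fst.prodMk (differentiableAt_sectionCoord hσ a).hasFDerivAt) ?_ ?_ w
  · filter_upwards [eventually_mem_bundleChartDomain ha] with p' hp'
    exact mem_extChartAt_bundle_source.2 hp'
  · filter_upwards [eventually_mem_bundleChartDomain ha] with p' hp'
    rw [sectionCoord_extChartAt σ hp', extChartAt_bundle hp',
      extChartAt_bundle (p := ⟨p'.proj, σ p'⟩) hp']

/-- Here the section takes values in `π^*E`, so its local form is the graph of `S` and keeps all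
coordinates of `a`; in `chartDeriv_mfderiv_section` only the base coordinate survives. -/
theorem chartDeriv_mfderiv_pullbackSection {σ : (a : TotalSpace F E) → E a.proj}
    (hσ : ContMDiff (I.prod 𝓘(ℝ, F)) (I.prod 𝓘(ℝ, F)) ∞
      (fun a : TotalSpace F E ↦ (⟨a.proj, σ a⟩ : TotalSpace F E)))
    (a : TotalSpace F E) (w : TangentSpace (I.prod 𝓘(ℝ, F)) a) :
    chartDeriv ((I.prod 𝓘(ℝ, F)).prod 𝓘(ℝ, F)) (diag I a) (⟨a, σ a⟩ : PullbackTotal I F E)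
      (mfderiv (I.prod 𝓘(ℝ, F)) ((I.prod 𝓘(ℝ, F)).prod 𝓘(ℝ, F))
        (fun e : TotalSpace F E ↦ (⟨e, σ e⟩ : PullbackTotal I F E)) a w) =
      (chartDeriv (I.prod 𝓘(ℝ, F)) a a w,
        fderiv ℝ (sectionCoord I a σ) (extChartAt (I.prod 𝓘(ℝ, F)) a a)
          (chartDeriv (I.prod 𝓘(ℝ, F)) a a w)) := by
  have ha := mem_bundleChartDomain_self (I := I) (F := F) (E := E) a.proj
  refine chartDeriv_mfderiv (x₀' := a) (p := a)
    (f := fun e : TotalSpace F E ↦ (⟨e, σ e⟩ : PullbackTotal I F E))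
    (k := fun y : V × F ↦ (y, sectionCoord I a σ y))
    (k' := (ContinuousLinearMap.id ℝ (V × F)).prod (fderiv ℝ (sectionCoord I a σ) _))
    (mem_extChartAt_source a)
    ((hasFDerivAt_id _).prodMk (differentiableAt_sectionCoord hσ a).hasFDerivAt) ?_ ?_ w
  · filter_upwards [eventually_mem_bundleChartDomain ha] with p' hp'
    exact mem_extChartAt_pullback_source.2 hp'
  · filter_upwards [eventually_mem_bundleChartDomain ha] with p' hp'
    rw [sectionCoord_extChartAt σ hp', extChartAt_bundle hp',
      extChartAt_pullback (p := ⟨p', σ p'⟩) hp']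

/-- The local form of the covariant derivative associated with the linearization. -/
theorem fibreCoord_linearizedCovariantDerivative {ξ : HorizontalLift I F E}
    (hξ : IsEhresmannConnection ξ) {σ : (a : TotalSpace F E) → E a.proj}
    (hσ : ContMDiff (I.prod 𝓘(ℝ, F)) (I.prod 𝓘(ℝ, F)) ∞
      (fun a : TotalSpace F E ↦ (⟨a.proj, σ a⟩ : TotalSpace F E)))
    (a : TotalSpace F E) (w : TangentSpace (I.prod 𝓘(ℝ, F)) a) :
    fibreCoord F a.proj (linearizedCovariantDerivative ξ σ a w) =
      fderiv ℝ (sectionCoord I a σ) (extChartAt (I.prod 𝓘(ℝ, F)) a a)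
          (chartDeriv (I.prod 𝓘(ℝ, F)) a a w) -
        fderiv ℝ (liftCoord ξ a) (extChartAt (I.prod 𝓘(ℝ, F)) a a,
          (chartDeriv (I.prod 𝓘(ℝ, F)) a a w).1) ((0, fibreCoord F a.proj (σ a)), 0) := by
  have ha := mem_bundleChartDomain_self (I := I) (F := F) (E := E) a.proj
  have hU := chartDeriv_mfderiv_pullbackSection hσ a w
  let p : PullbackTotal I F E := ⟨a, σ a⟩
  have hp : p.proj ∈ bundleChartDomain (I.prod 𝓘(ℝ, F)) F (proj I F E *ᵖ E) (diag I a).proj :=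
    mem_bundleChartDomain_pullback.2 ha
  set U : TangentSpace ((I.prod 𝓘(ℝ, F)).prod 𝓘(ℝ, F)) p :=
    mfderiv (I.prod 𝓘(ℝ, F)) ((I.prod 𝓘(ℝ, F)).prod 𝓘(ℝ, F))
        (fun e : TotalSpace F E ↦ (⟨e, σ e⟩ : PullbackTotal I F E)) a w with hUdef
  set y := extChartAt (I.prod 𝓘(ℝ, F)) a a
  -- A section followed by the projection is the identity, so the linearized lift is evaluated at
  -- `w` itself.
  have hT : tangentProj (I.prod 𝓘(ℝ, F)) (E := proj I F E *ᵖ E) p U = w := by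
    apply (chartDeriv_bijective (mem_extChartAt_source (I := I.prod 𝓘(ℝ, F)) a)).1
    exact (chartDeriv_tangentProj (a₀ := diag I a) hp U).trans (congrArg Prod.fst hU)
  have hB := chartDeriv_linearizationB hξ (a₀ := a) (m := a.proj) ha a.2 (σ a) w
  have hL : chartDeriv ((I.prod 𝓘(ℝ, F)).prod 𝓘(ℝ, F)) (diag I a) p (linearization ξ p w) =
      (chartDeriv (I.prod 𝓘(ℝ, F)) a a w,
        fderiv ℝ (liftCoord ξ a) (y, (chartDeriv (I.prod 𝓘(ℝ, F)) a a w).1)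
          ((0, fibreCoord F a.proj (σ a)), 0)) := by
    refine (chartDeriv_pairTangent (a₀ := a) (p := p) ha w (linearizationB ξ a.2 (σ a) w)
      (Prod.ext_iff.1 hB).1.symm).trans ?_
    exact Prod.ext rfl (Prod.ext_iff.1 hB).2
  have hV : chartDeriv ((I.prod 𝓘(ℝ, F)).prod 𝓘(ℝ, F)) (diag I a) p
      (vertProjector (E := proj I F E *ᵖ E) (linearization ξ) p U) =
      (0, fderiv ℝ (sectionCoord I a σ) y (chartDeriv (I.prod 𝓘(ℝ, F)) a a w) -
        fderiv ℝ (liftCoord ξ a) (y, (chartDeriv (I.prod 𝓘(ℝ, F)) a a w).1)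
          ((0, fibreCoord F a.proj (σ a)), 0)) := by
    rw [vertProjector, horProjector, hT, map_sub, hL, hU]
    exact Prod.ext (sub_self _) rfl
  -- This form of the connector lemma asks only for verticality, given by `hV`, and not that
  -- `linearization ξ` be an Ehresmann connection.
  have h := fibreCoord_connector (E := proj I F E *ᵖ E) (ξ := linearization ξ)
    (a₀ := diag I a) (a := p) hp U (by rw [hV])
  rw [hV] at h
  exact h

/-- The local form of the connector applied to the bracket of a horizontal and a vertical field. -/
theorem fibreCoord_connector_mlieBracket {ξ : HorizontalLift I F E}
    (hξ : IsEhresmannConnection ξ) {σ : (a : TotalSpace F E) → E a.proj}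
    (hσ : ContMDiff (I.prod 𝓘(ℝ, F)) (I.prod 𝓘(ℝ, F)) ∞
      (fun a : TotalSpace F E ↦ (⟨a.proj, σ a⟩ : TotalSpace F E)))
    {W : (a : TotalSpace F E) → TangentSpace (I.prod 𝓘(ℝ, F)) a}
    (hW : ContMDiff (I.prod 𝓘(ℝ, F)) (I.prod 𝓘(ℝ, F)).tangent ∞
      (fun a ↦ (⟨a, W a⟩ : TangentBundle (I.prod 𝓘(ℝ, F)) (TotalSpace F E))))
    (a : TotalSpace F E) :
    fibreCoord F a.proj (connector ξ a (VectorField.mlieBracket (I.prod 𝓘(ℝ, F))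
        (fun e ↦ horProjector ξ e (W e)) (fun e ↦ vertLift I e (σ e)) a)) =
      fderiv ℝ (sectionCoord I a σ) (extChartAt (I.prod 𝓘(ℝ, F)) a a)
          ((chartDeriv (I.prod 𝓘(ℝ, F)) a a (W a)).1,
            liftCoord ξ a (extChartAt (I.prod 𝓘(ℝ, F)) a a,
              (chartDeriv (I.prod 𝓘(ℝ, F)) a a (W a)).1)) -
        fderiv ℝ (liftCoord ξ a) (extChartAt (I.prod 𝓘(ℝ, F)) a a,
          (chartDeriv (I.prod 𝓘(ℝ, F)) a a (W a)).1) ((0, fibreCoord F a.proj (σ a)), 0) := by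
  have ha := mem_bundleChartDomain_self (I := I) (F := F) (E := E) a.proj
  rw [fibreCoord_connector_eq hξ ha, chartDeriv_mlieBracket]
  have hfix : ∀ Z : (a : TotalSpace F E) → TangentSpace (I.prod 𝓘(ℝ, F)) a,
      chartField (I.prod 𝓘(ℝ, F)) a Z (extChartAt (I.prod 𝓘(ℝ, F)) a a) =
        chartDeriv (I.prod 𝓘(ℝ, F)) a a (Z a) := by
    intro Z
    unfold chartField
    rw [extChartAt_to_inv]
  set y := extChartAt (I.prod 𝓘(ℝ, F)) a a with hy
  set X : V × F → V := fun z ↦ (chartField (I.prod 𝓘(ℝ, F)) a W z).1 with hX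
  have hX0 : (chartDeriv (I.prod 𝓘(ℝ, F)) a a (W a)).1 = X y := by
    rw [hX, ← hfix W]
  rw [hX0]
  have hXd : DifferentiableAt ℝ X y := (differentiableAt_chartField hW a).fst
  have hS := differentiableAt_sectionCoord hσ a
  have hG := differentiableAt_liftCoord hξ ha (X y)
  -- The horizontal part of `W` depends only on the base component `X`. The bracket involves
  -- derivatives, so the local forms are needed on a neighbourhood of `y`.
  have e1 : chartField (I.prod 𝓘(ℝ, F)) a (fun e ↦ horProjector ξ e (W e)) =ᶠ[𝓝 y]
      fun z ↦ (X z, liftCoord ξ a (z, X z)) := by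
    filter_upwards [extChartAt_target_mem_nhds (I := I.prod 𝓘(ℝ, F)) a] with z hz
    have hz' := mem_extChartAt_bundle_source.1 ((extChartAt (I.prod 𝓘(ℝ, F)) a).map_target hz)
    refine (chartDeriv_lift hξ hz' _).trans ?_
    rw [chartDeriv_tangentProj hz', (extChartAt (I.prod 𝓘(ℝ, F)) a).right_inv hz]
    rfl
  have e2 : chartField (I.prod 𝓘(ℝ, F)) a (fun e ↦ vertLift I e (σ e)) =ᶠ[𝓝 y]
      fun z ↦ (0, sectionCoord I a σ z) := by
    filter_upwards [extChartAt_target_mem_nhds (I := I.prod 𝓘(ℝ, F)) a] with z hz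
    have hz' := mem_extChartAt_bundle_source.1 ((extChartAt (I.prod 𝓘(ℝ, F)) a).map_target hz)
    exact chartDeriv_vertLift hz' _
  rw [e1.lieBracket_vectorField_eq e2, VectorField.lieBracket]
  have d1 : HasFDerivAt (fun z ↦ ((0 : V), sectionCoord I a σ z))
      ((0 : V × F →L[ℝ] V).prod (fderiv ℝ (sectionCoord I a σ) y)) y :=
    (hasFDerivAt_const (0 : V) y).prodMk hS.hasFDerivAt
  have d2 : HasFDerivAt (fun z ↦ (X z, liftCoord ξ a (z, X z)))
      ((fderiv ℝ X y).prod ((fderiv ℝ (liftCoord ξ a) (y, X y)).comp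
        ((ContinuousLinearMap.id ℝ (V × F)).prod (fderiv ℝ X y)))) y :=
    hXd.hasFDerivAt.prodMk (HasFDerivAt.comp y (f := fun z ↦ (z, X z)) hG.hasFDerivAt
      ((hasFDerivAt_id y).prodMk hXd.hasFDerivAt))
  rw [d1.fderiv, d2.fderiv, sectionCoord_extChartAt σ ha]
  have hlin := isLinearMap_liftCoord hξ ha
  -- A linear map is its own derivative: along the velocity variable, `liftCoord` is affine on every
  -- line.
  have hpart : ∀ x : V, fderiv ℝ (liftCoord ξ a) (y, X y) (0, x) = liftCoord ξ a (y, x) := by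
    intro x
    have h1 : HasDerivAt (fun s : ℝ ↦ liftCoord ξ a (y, X y + s • x))
        (fderiv ℝ (liftCoord ξ a) (y, X y) (0, x)) 0 := by
      have hf : HasFDerivAt (liftCoord ξ a) (fderiv ℝ (liftCoord ξ a) (y, X y))
          (y, X y + (0 : ℝ) • x) := by
        rw [zero_smul, add_zero]
        exact hG.hasFDerivAt
      exact hf.comp_hasDerivAt (0 : ℝ)
        ((hasDerivAt_const (0 : ℝ) y).prodMk (hasDerivAt_add_smul_zero (X y) x))
    have h2 : (fun s : ℝ ↦ liftCoord ξ a (y, X y + s • x)) =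
        fun s : ℝ ↦ liftCoord ξ a (y, X y) + s • liftCoord ξ a (y, x) := by
      funext s
      rw [hlin.map_add, hlin.map_smul]
    rw [h2] at h1
    exact h1.unique (hasDerivAt_add_smul_zero _ _)
  set s := fibreCoord F a.proj (σ a)
  have hsplit : fderiv ℝ (liftCoord ξ a) (y, X y) ((0, s), fderiv ℝ X y (0, s)) =
      fderiv ℝ (liftCoord ξ a) (y, X y) ((0, s), 0) + liftCoord ξ a (y, fderiv ℝ X y (0, s)) := by
    rw [← hpart, ← map_add]
    simp
  -- The base component of the bracket is `0 - dX(0, s)`. The connector subtracts its lift, which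
  -- cancels the last term of `hsplit`.
  have hneg : liftCoord ξ a (y, 0 - fderiv ℝ X y (0, s)) =
      - liftCoord ξ a (y, fderiv ℝ X y (0, s)) := by
    rw [zero_sub, hlin.map_neg]
  change fderiv ℝ (sectionCoord I a σ) y (X y, liftCoord ξ a (y, X y)) -
    fderiv ℝ (liftCoord ξ a) (y, X y) ((0, s), fderiv ℝ X y (0, s)) -
    liftCoord ξ a (y, 0 - fderiv ℝ X y (0, s)) = _
  rw [hsplit, hneg]
  abel

end CovariantDerivative

end NonlinearConnection

end

/-! ### The theorem, by comparison of fibre coordinates. -/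

theorem theorem5p2
    {V : Type*} [NormedAddCommGroup V] [NormedSpace ℝ V] [CompleteSpace V]
    {H : Type*} [TopologicalSpace H] (I : ModelWithCorners ℝ V H) [I.Boundaryless]
    {M : Type*} [TopologicalSpace M] [ChartedSpace H M] [IsManifold I ∞ M]
    {F : Type*} [NormedAddCommGroup F] [NormedSpace ℝ F] [CompleteSpace F]
    {E : M → Type*} [∀ x, AddCommGroup (E x)] [∀ x, Module ℝ (E x)]
    [TopologicalSpace (TotalSpace F E)] [∀ x, TopologicalSpace (E x)] [FiberBundle F E]
    [VectorBundle ℝ F E] [ContMDiffVectorBundle ∞ F E I]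
    -- a nonlinear connection on `E`
    (ξ : NonlinearConnection.HorizontalLift I F E)
    (hξ : NonlinearConnection.IsEhresmannConnection ξ)
    -- a smooth section of `E` along `π`
    (σ : (a : TotalSpace F E) → E a.proj)
    (hσ : ContMDiff (I.prod 𝓘(ℝ, F)) (I.prod 𝓘(ℝ, F)) ∞
      (fun a : TotalSpace F E ↦ (⟨a.proj, σ a⟩ : TotalSpace F E)))
    -- a smooth vector field on `E`
    (W : (a : TotalSpace F E) → TangentSpace (I.prod 𝓘(ℝ, F)) a)
    (hW : ContMDiff (I.prod 𝓘(ℝ, F)) (I.prod 𝓘(ℝ, F)).tangent ∞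
      (fun a ↦ (⟨a, W a⟩ : TangentBundle (I.prod 𝓘(ℝ, F)) (TotalSpace F E))))
    (a : TotalSpace F E) :
    NonlinearConnection.linearizedCovariantDerivative ξ σ a (W a) =
      NonlinearConnection.connector ξ a
        (VectorField.mlieBracket (I.prod 𝓘(ℝ, F))
          (fun e ↦ NonlinearConnection.horProjector ξ e (W e))
          (fun e ↦ NonlinearConnection.vertLift I e (σ e)) a) +
      NonlinearConnection.connector ξ ⟨a.proj, σ a⟩
        (mfderiv (I.prod 𝓘(ℝ, F)) (I.prod 𝓘(ℝ, F))
          (fun e : TotalSpace F E ↦ (⟨e.proj, σ e⟩ : TotalSpace F E)) a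
          (NonlinearConnection.vertProjector ξ a (W a))) := by
  open NonlinearConnection in
  have ha := mem_bundleChartDomain_self (I := I) (F := F) (E := E) a.proj
  apply (fibreCoord_bijective (F := F) (m₀ := a.proj) ha.1).1
  rw [fibreCoord_add ha.1, fibreCoord_linearizedCovariantDerivative hξ hσ,
    fibreCoord_connector_mlieBracket hξ hσ hW]
  have h3 := fibreCoord_connector_eq hξ (a₀ := a) (a := ⟨a.proj, σ a⟩) ha
    (mfderiv (I.prod 𝓘(ℝ, F)) (I.prod 𝓘(ℝ, F))
          (fun e : TotalSpace F E ↦ (⟨e.proj, σ e⟩ : TotalSpace F E)) a (vertProjector ξ a (W a)))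
  -- The vertical part of `W` has zero base velocity, and so does its image under `Tσ`. The lift
  -- that `κ` subtracts is therefore zero.
  rw [chartDeriv_mfderiv_section hσ, chartDeriv_vertProjector hξ ha,
    (isLinearMap_liftCoord hξ (a₀ := a) (a := ⟨a.proj, σ a⟩) ha).map_zero, sub_zero] at h3
  -- The two arguments of `dS` are the horizontal and vertical parts of `W`, whose sum is `W`.
  rw [h3, sub_add_eq_add_sub, ← map_add]
  simp
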